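/- Let $\Theta\subseteq\mathbb R^d$ be open and convex, let $x_1,\dots,x_N\in\mathcal X$ ($N\ge1$), let $t>0$, and let $f:\mathcal X\times\Theta\to[F_{\min},F_{\max}]$ be $L$-Lipschitz in $\theta$, i.e. $|f(x;\theta)-f(x;\theta')|\le L\|\theta-\theta'\|$ for all $x\in\mathcal X$ and $\theta,\theta'\in\Theta$, with each $f(x_i;\cdot)$ continuously differentiable on $\Theta$. Let $$\widetilde R(t;\theta)=\frac1t\log\Big(\frac1N\sum_{i=1}^N e^{tf(x_i;\theta)}\Big).$$ Assume that $\widetilde R(t;\cdot)$ is $\mu$-strongly convex on $\Theta$ with $\mu>0$, let $\theta^*\in\arg\min_{\theta\in\Theta}\widetilde R(t;\theta)$, and assume that $$\Big\|\frac{e^{tf(x_i;\theta)}}{e^{t\widetilde R(t;\theta)}}\nabla_\theta f(x_i;\theta)\Big\|\le B\qquad\text{for all } i\in[N],\ \theta\in\Theta .$$ Let $k_t$ be the largest integer $k\ge1$ with $$k<\frac{2e}{\mu}+\frac{e\,tLB\,e^{t(F_{\max}-F_{\min})}}{\mu k}$$ ($k_t=1$ if there is none). Put $\lambda=1-\frac1{2e}$,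 $\alpha_k=\frac1{1+tLBe^{t(F_{\max}-F_{\min})}}$ for $1\le k<k_t$, and $\alpha_k=\frac{2e}{\mu k}$ for $k\ge k_t$. Consider the two-minibatch stochastic TERM solver with batch size $1$. Let $\theta_1$ be a (possibly random) initial point and let $\zeta_1,\xi_1,\zeta_2,\xi_2,\dots$ be mutually independent and uniform on $[N]$, and independent of $\theta_1$. Start from $\widehat R_0=\widetilde R(t;\theta_1)$, and for $k=1,2,\dots$ set $$\widehat R_k=\frac1t\log\Big((1-\lambda)e^{t\widehat R_{k-1}}+\lambda e^{tf(x_{\xi_k};\theta_k)}\Big),\qquad \theta_{k+1}=\theta_k-\alpha_k\,e^{tf(x_{\zeta_k};\theta_k)-t\widehat R_k}\,\nabla_\theta f(x_{\zeta_k};\theta_k).$$ Assume that almost surely all the iterates $\theta_k$, $k\ge1$, lie in $\Theta$. Then $\mathbb E\|\theta_k-\theta^*\|^2<\infty$ for every $k\ge1$, and for all $k\ge k_t$ $$\mathbb E\big[\|\theta_{k+1}-\theta^*\|^2\big]\le\frac{V_t}{k+1},\qquad V_t=\max\Big\{k_t\,\mathbb E\big[\|\theta_{k_t}-\theta^*\|^2\big],\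 \frac{4B^2e^{2+2t(F_{\max}-F_{\min})}}{\mu^2}\Big\},$$ and moreover $$\mathbb E\big[\|\theta_{k_t}-\theta^*\|^2\big]\le\max\Big\{\mathbb E\big[\|\theta_1-\theta^*\|^2\big],\ \frac{B^2e^{2t(F_{\max}-F_{\min})+1}}{\mu\big(1+tLBe^{t(F_{\max}-F_{\min})}\big)}\Big\}.$$ -/

import Mathlib

open MeasureTheory ProbabilityTheory

noncomputable section

namespace TERM

variable {𝒳 : Type*} {d N : ℕ}

/-- The `t`-tilted loss on the subsample `S ⊆ [N]`:
`(1/t) log ((1/|S|) ∑_{i ∈ S} exp (t f(x_i; θ)))`. -/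
def tiltedLossOn (f : 𝒳 → EuclideanSpace ℝ (Fin d) → ℝ) (x : Fin N → 𝒳) (t : ℝ)
    (S : Finset (Fin N)) (θ : EuclideanSpace ℝ (Fin d)) : ℝ :=
  (1 / t) * Real.log ((1 / (S.card : ℝ)) * ∑ i ∈ S, Real.exp (t * f (x i) θ))

/-- The `t`-tilted loss `R̃(t; θ)` on all the data. -/
def tiltedLoss (f : 𝒳 → EuclideanSpace ℝ (Fin d) → ℝ) (x : Fin N → 𝒳) (t : ℝ)
    (θ : EuclideanSpace ℝ (Fin d)) : ℝ :=
  tiltedLossOn f x t Finset.univ θ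

/-- The stochastic gradient `∇R̃(x_i; θ) = (e^{t f(x_i; θ)} / e^{t R̃(t; θ)}) ∇f(x_i; θ)`. -/
def tiltedStochGrad (f : 𝒳 → EuclideanSpace ℝ (Fin d) → ℝ) (x : Fin N → 𝒳) (t : ℝ)
    (i : Fin N) (θ : EuclideanSpace ℝ (Fin d)) : EuclideanSpace ℝ (Fin d) :=
  (Real.exp (t * f (x i) θ) / Real.exp (t * tiltedLoss f x t θ)) • gradient (f (x i)) θ

/-- Tilted averaging of the current normalizer estimate `R` with the `t`-tilted loss on the
minibatch `B₂` at the current parameter `θ`. -/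
def updateNormalizer (f : 𝒳 → EuclideanSpace ℝ (Fin d) → ℝ) (x : Fin N → 𝒳) (t lam : ℝ)
    (B₂ : Finset (Fin N)) (θ : EuclideanSpace ℝ (Fin d)) (R : ℝ) : ℝ :=
  (1 / t) * Real.log ((1 - lam) * Real.exp (t * R)
    + lam * Real.exp (t * tiltedLossOn f x t B₂ θ))

/-- Gradient step on the minibatch `B₁` with weights `e^{t f(x_i; θ) - t R}`. -/
def updateParam (f : 𝒳 → EuclideanSpace ℝ (Fin d) → ℝ) (x : Fin N → 𝒳) (t α : ℝ)
    (B₁ : Finset (Fin N)) (θ : EuclideanSpace ℝ (Fin d)) (R : ℝ) : EuclideanSpace ℝ (Fin d) :=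
  θ - (α / (B₁.card : ℝ)) •
    ∑ i ∈ B₁, Real.exp (t * f (x i) θ - t * R) • gradient (f (x i)) θ

/-- The pair (parameter, normalizer estimate) after `n` iterations of the stochastic solver with
two minibatches. Iterations are numbered `1, 2, …`; iteration `k` uses the step size `α k`, the
minibatch `B₁ k` for the gradients and `B₂ k` for the normalizer, and the gradient step uses the
freshly updated normalizer. -/
def solverState (f : 𝒳 → EuclideanSpace ℝ (Fin d) → ℝ) (x : Fin N → 𝒳) (t lam : ℝ)
    (α : ℕ → ℝ) (B₁ B₂ : ℕ → Finset (Fin N)) (θ₁ : EuclideanSpace ℝ (Fin d)) :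
    ℕ → EuclideanSpace ℝ (Fin d) × ℝ
  | 0 => (θ₁, tiltedLoss f x t θ₁)
  | n + 1 =>
    let s := solverState f x t lam α B₁ B₂ θ₁ n
    let R := updateNormalizer f x t lam (B₂ (n + 1)) s.1 s.2
    (updateParam f x t (α (n + 1)) (B₁ (n + 1)) s.1 R, R)

/-- The iterate `θ_k`, `k ≥ 1`: the parameter at the start of iteration `k`. -/
def solverIterate (f : 𝒳 → EuclideanSpace ℝ (Fin d) → ℝ) (x : Fin N → 𝒳) (t lam : ℝ)
    (α : ℕ → ℝ) (B₁ B₂ : ℕ → Finset (Fin N)) (θ₁ : EuclideanSpace ℝ (Fin d)) (k : ℕ) :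
    EuclideanSpace ℝ (Fin d) :=
  (solverState f x t lam α B₁ B₂ θ₁ (k - 1)).1

/-- The burn-in `k_t`: the largest integer `k ≥ 1` with
`k < 2e/μ + e t L B e^{t (Fmax - Fmin)} / (μ k)`, and `1` if there is none. -/
def burnIn (t L B μ Fmin Fmax : ℝ) : ℕ :=
  max 1 (sSup {k : ℕ | 1 ≤ k ∧ (k : ℝ) < 2 * Real.exp 1 / μ
    + Real.exp 1 * t * L * B * Real.exp (t * (Fmax - Fmin)) / (μ * k)})

/-- The step sizes: constant during the burn-in, `2e/(μ k)` from then on. -/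
def stepSize (t L B μ Fmin Fmax : ℝ) (k : ℕ) : ℝ :=
  if k < burnIn t L B μ Fmin Fmax then
    1 / (t * L * B * Real.exp (t * (Fmax - Fmin)) + 1)
  else 2 * Real.exp 1 / (μ * k)

/-- The averaging parameter `λ = 1 - 1/(2e)`. -/
def avgParam : ℝ := 1 - 1 / (2 * Real.exp 1)

/-- `θ_k` for the above step sizes and averaging parameter and minibatches of size one: at
iteration `k` the gradient is taken at the sample `ζ k`, the normalizer is updated with `ξ k`. -/
def termIterate (f : 𝒳 → EuclideanSpace ℝ (Fin d) → ℝ) (x : Fin N → 𝒳)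
    (t L B μ Fmin Fmax : ℝ) (ζ ξ : ℕ → Fin N) (θ₁ : EuclideanSpace ℝ (Fin d)) (k : ℕ) :
    EuclideanSpace ℝ (Fin d) :=
  solverIterate f x t avgParam (stepSize t L B μ Fmin Fmax)
    (fun k => {ζ k}) (fun k => {ξ k}) θ₁ k

end TERM

end

/-!
The samples of one iteration reach all later iterations through the normalizer estimate, so that
estimate is not independent of the squared distance to the minimizer. What closes the recursion is
to track, next to `D n = E ‖θ_n - θ*‖²`, the weighted distance `P n = E [ρ ‖θ_n - θ*‖²]`, where `ρ`
is the ratio of the exponentiated estimated normalizer to the exact one. A gradient step contracts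
with a random rate proportional to `1/ρ`; since `1/ρ ≥ 2/r - ρ/r²` for every constant `r > 0`, a
bound `P n ≤ r D n` turns this into a deterministic contraction of `D`, and `r = 2e` suffices for
the rates of the theorem. Tilted averaging makes `P` forget its past geometrically, up to an error
from the motion of the parameter. Where the bound on `P` is not available, the noise is small enough
already, because `‖θ - θ*‖²` is bounded both by `B²/μ²` and by the oscillation of the loss over `μ`.
-/

noncomputable section

namespace TERM

open scoped BigOperators

section Recursion

/-- The value of the mean squared distance at which the contraction `1 - a μ / e` of a step of size
`a` balances the noise `(a B exp (t Δ))²` of that step. -/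
def noiseFloor (t B μ Δ a : ℝ) : ℝ :=
  Real.exp 1 * (B * Real.exp (t * Δ)) ^ 2 * a / μ

/-- The recursive inequalities satisfied by the mean squared distance `D n` to the minimizer and by
its mean `P n` weighted by the ratio of the estimated to the exact normalizer, for step sizes `α n`,
averaging parameter `lam`, tilt `t`, gradient bound `B`, convexity modulus `μ` and loss range `Δ`.
-/
structure DescentBounds (D P α : ℕ → ℝ) (lam t B μ Δ : ℝ) : Prop where
  lam_le_one : lam ≤ 1
  pos_t : 0 < t
  pos_mu : 0 < μ
  nonneg_B : 0 ≤ B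
  nonneg_dist : ∀ n, 0 ≤ D n
  nonneg_weighted : ∀ n, 0 ≤ P n
  dist_le_sq_div : ∀ n, D n ≤ B ^ 2 / μ ^ 2
  dist_le_range_div : ∀ n, D n ≤ 2 * Δ / μ
  weighted_zero_le : P 0 ≤ D 0
  weighted_le : ∀ n, P n ≤ Real.exp (t * Δ) * D n
  contract : ∀ n r, 0 < r → P n ≤ r * D n →
    D (n + 1) ≤ (1 - 2 * α n * μ / r) * D n + (α n * B * Real.exp (t * Δ)) ^ 2
  growth : ∀ n, D (n + 1) ≤ D n + (α n * B * Real.exp (t * Δ)) ^ 2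
  dist_le_succ : ∀ n, D n ≤ 5 / 4 * D (n + 1) + 5 * (α n * B * Real.exp (t * Δ)) ^ 2
  weighted_succ_le : ∀ n, P (n + 1) ≤
    (1 - lam) * (Real.exp (t * B * (α n * B * Real.exp (t * Δ))) *
      (5 / 4 * P n + 5 * Real.exp (t * Δ) * (α n * B * Real.exp (t * Δ)) ^ 2)) + lam * D (n + 1)

variable {D P α : ℕ → ℝ} {lam t B μ Δ a : ℝ}

theorem noiseFloor_eq_sq_mul :
    noiseFloor t B μ Δ a = B ^ 2 * Real.exp (2 * t * Δ + 1) * a / μ := by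
  rw [noiseFloor, show 2 * t * Δ + 1 = 1 + (t * Δ + t * Δ) by ring, Real.exp_add, Real.exp_add]
  ring

theorem noiseFloor_two_exp_one_div (k : ℝ) :
    noiseFloor t B μ Δ (2 * Real.exp 1 / (μ * k))
      = 4 * B ^ 2 * Real.exp (2 + 2 * t * Δ) / μ ^ 2 / (2 * k) := by
  rw [noiseFloor_eq_sq_mul, show 2 + 2 * t * Δ = 2 * t * Δ + 1 + 1 by ring,
    Real.exp_add (2 * t * Δ + 1)]
  field_simp
  ring

theorem sq_noise_eq_mul_noiseFloor (hμ : μ ≠ 0) :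
    (a * B * Real.exp (t * Δ)) ^ 2 = a * μ / Real.exp 1 * noiseFloor t B μ Δ a := by
  rw [noiseFloor]
  field_simp

theorem exp_one_half_le : Real.exp (1 / 2) ≤ 1.65 := by
  have hsq : Real.exp (1 / 2) ^ 2 = Real.exp 1 := by
    rw [← Real.exp_nat_mul]
    norm_num
  nlinarith [Real.exp_pos (1 / 2), Real.exp_one_lt_d9]

theorem two_mul_le_exp_one_div_four_mul_exp {l : ℝ} (hl : 5 ≤ Real.exp l) :
    2 * l ≤ Real.exp 1 / 4 * Real.exp l := by
  have hsq : Real.exp l = Real.exp (l / 2) ^ 2 := by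
    rw [← Real.exp_nat_mul]
    congr 1
    push_cast
    ring
  have htangent : l / 2 * Real.exp 1 ≤ Real.exp (l / 2) := by
    have := Real.add_one_le_exp (l / 2 - 1)
    rwa [sub_add_cancel, Real.exp_sub, le_div_iff₀ (Real.exp_pos 1)] at this
  have hroot : 2.2 ≤ Real.exp (l / 2) := by nlinarith [Real.exp_pos (l / 2)]
  have hsq_e : 7.38 ≤ Real.exp 1 ^ 2 := by nlinarith [Real.exp_one_gt_d9]
  have hmul : 16 * Real.exp (l / 2) ≤ Real.exp 1 ^ 2 * Real.exp (l / 2) ^ 2 := by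
    nlinarith [mul_le_mul hsq_e hroot (by norm_num) (by positivity), Real.exp_pos (l / 2)]
  refine le_of_mul_le_mul_right ?_ (Real.exp_pos 1)
  rw [hsq]
  linarith

theorem harmonic_contraction_le {V k : ℝ} (hV : 0 ≤ V) (hk : 0 < k) :
    (1 - 2 / k) * (V / k) + 2 / k * (V / (2 * k)) ≤ V / (k + 1) := by
  have heq : (1 - 2 / k) * (V / k) + 2 / k * (V / (2 * k)) = V * ((k - 1) / k ^ 2) := by
    field_simp
    ring
  rw [heq, div_eq_mul_one_div V (k + 1)]
  refine mul_le_mul_of_nonneg_left ?_ hV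
  rw [div_le_div_iff₀ (by positivity) (by positivity)]
  linarith

namespace DescentBounds

theorem one_le_exp (h : DescentBounds D P α lam t B μ Δ) : 1 ≤ Real.exp (t * Δ) := by
  have hΔ : 0 ≤ 2 * Δ := nonneg_of_mul_nonneg_left
    ((h.nonneg_dist 0).trans (h.dist_le_range_div 0)) (inv_pos.2 h.pos_mu)
  exact Real.one_le_exp (mul_nonneg h.pos_t.le (by linarith))

theorem weighted_le_of_window (h : DescentBounds D P α lam t B μ Δ) (hlam : 1 - lam ≤ 0.185)
    (hs : 5 ≤ Real.exp (t * Δ)) {n₀ : ℕ} {p δ : ℝ} (hp₀ : 0 ≤ p) (hp : p ≤ Real.exp (t * Δ))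
    (hstart : P n₀ ≤ (2 + p) * D n₀) (hδ : t * B * δ ≤ 1 / 2) (i : ℕ)
    (hα₀ : ∀ j < i, 0 ≤ α (n₀ + j)) (hα : ∀ j < i, α (n₀ + j) * B * Real.exp (t * Δ) ≤ δ) :
    P (n₀ + i) ≤ (2 + p / 2 ^ i) * D (n₀ + i) + 7 * Real.exp (t * Δ) * δ ^ 2 := by
  induction i with
  | zero => simpa using hstart.trans (le_add_of_nonneg_right (by positivity))
  | succ i ih =>
    have hPi := ih (fun j hj => hα₀ j (by omega)) fun j hj => hα j (by omega)
    have hB := h.nonneg_B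
    have ht := h.pos_t
    have hD := h.nonneg_dist (n₀ + i + 1)
    have hδi := hα i (by omega)
    have hδi₀ : 0 ≤ α (n₀ + i) * B * Real.exp (t * Δ) := by
      have := hα₀ i (by omega)
      positivity
    have hsucc := h.dist_le_succ (n₀ + i)
    have hPsucc := h.weighted_succ_le (n₀ + i)
    have hPnonneg := h.nonneg_weighted (n₀ + i)
    have hlam₁ := h.lam_le_one
    set s := Real.exp (t * Δ)
    set q := p / 2 ^ i with hq
    have : 0 ≤ q := by positivity
    have hqs : q ≤ s := (div_le_self hp₀ (one_le_pow₀ one_le_two)).trans hp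
    have hdrift : Real.exp (t * B * (α (n₀ + i) * B * s)) ≤ 1.65 :=
      (Real.exp_le_exp.2 ((by gcongr : _ ≤ t * B * δ).trans hδ)).trans exp_one_half_le
    have hPstep : P (n₀ + i + 1) ≤ 0.185 * (1.65 * (5 / 4 * P (n₀ + i) + 5 * s * δ ^ 2))
        + 1 * D (n₀ + i + 1) := hPsucc.trans (by gcongr)
    have hDstep : (2 + q) * D (n₀ + i) ≤ (2 + q) * (5 / 4 * D (n₀ + i + 1) + 5 * δ ^ 2) := by
      gcongr
      exact hsucc.trans (by gcongr)
    have hq_halved : p / 2 ^ (i + 1) = q / 2 := by rw [hq, pow_succ, div_div]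
    have hqD : 0 ≤ q * D (n₀ + i + 1) := by positivity
    have hqδ : (2 + q) * δ ^ 2 ≤ 1.4 * s * δ ^ 2 := by
      gcongr
      linarith
    have : 0 ≤ s * δ ^ 2 := by positivity
    rw [← add_assoc, hq_halved]
    linarith

theorem rate_lt_of_noiseFloor_lt (h : DescentBounds D P α lam t B μ Δ)
    (hF : noiseFloor t B μ Δ a < B ^ 2 / μ ^ 2) :
    Real.exp 1 ^ 2 * Real.exp (t * Δ) ^ 2 * (a * μ / Real.exp 1) < 1 := by
  have hμ := h.pos_mu
  have hlt : Real.exp 1 ^ 2 * Real.exp (t * Δ) ^ 2 * (a * μ / Real.exp 1) * (B ^ 2 / μ ^ 2)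
      < 1 * (B ^ 2 / μ ^ 2) := by
    rw [one_mul]
    convert hF using 1
    rw [noiseFloor]
    field_simp
  exact lt_of_mul_lt_mul_right hlt (by positivity)

theorem rate_le_half (h : DescentBounds D P α lam t B μ Δ)
    (hF : noiseFloor t B μ Δ a < B ^ 2 / μ ^ 2) : a * μ / Real.exp 1 ≤ 1 / 2 := by
  have he : 2 ≤ Real.exp 1 ^ 2 := by nlinarith [Real.exp_one_gt_d9]
  have hcoef : 2 ≤ Real.exp 1 ^ 2 * Real.exp (t * Δ) ^ 2 :=
    he.trans (le_mul_of_one_le_right (by positivity) (one_le_pow₀ h.one_le_exp))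
  by_contra! hr
  nlinarith [h.rate_lt_of_noiseFloor_lt hF]

theorem drift_le_of_noiseFloor_lt (h : DescentBounds D P α lam t B μ Δ)
    (hs : 5 ≤ Real.exp (t * Δ)) (hF : noiseFloor t B μ Δ a < 2 * Δ / μ) :
    t * B * (2 * a * B * Real.exp (t * Δ)) ≤ 1 / 2 := by
  have ht := h.pos_t
  have hlog := two_mul_le_exp_one_div_four_mul_exp hs
  rw [noiseFloor, div_lt_div_iff_of_pos_right h.pos_mu] at hF
  have hscaled : t * (Real.exp 1 * (B * Real.exp (t * Δ)) ^ 2 * a) < t * (2 * Δ) := by gcongr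
  have hmul : Real.exp 1 * Real.exp (t * Δ) * (t * B * (2 * a * B * Real.exp (t * Δ)))
      ≤ Real.exp 1 * Real.exp (t * Δ) * (1 / 2) := by linarith
  exact le_of_mul_le_mul_left hmul (by positivity)

theorem weighted_le_two_exp_mul (h : DescentBounds D P α lam t B μ Δ) (hlam : 1 - lam ≤ 0.185)
    {n₀ i : ℕ} {p : ℝ} (hp₀ : 0 ≤ p) (hp : p ≤ Real.exp (t * Δ)) (hpi : p ≤ 2 ^ i)
    (hstart : P n₀ ≤ (2 + p) * D n₀) (hα₀ : ∀ j < i, 0 ≤ α (n₀ + j))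
    (hα : ∀ j < i, α (n₀ + j) ≤ 2 * a) (ha : 0 < a)
    (hFB : noiseFloor t B μ Δ a < B ^ 2 / μ ^ 2) (hFΔ : noiseFloor t B μ Δ a < 2 * Δ / μ)
    (hD : noiseFloor t B μ Δ a / 2 < D (n₀ + i)) :
    P (n₀ + i) ≤ 2 * Real.exp 1 * D (n₀ + i) := by
  have he := Real.exp_one_gt_d9
  have hB := h.nonneg_B
  have hμ := h.pos_mu
  have hDpos := h.nonneg_dist (n₀ + i)
  rcases le_total (Real.exp (t * Δ)) 5 with hs | hs
  · refine (h.weighted_le _).trans ?_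
    gcongr
    linarith
  have hP := h.weighted_le_of_window hlam hs hp₀ hp hstart (h.drift_le_of_noiseFloor_lt hs hFΔ) i
    hα₀ fun j hj => by
      have := hα j hj
      gcongr
  have hnoise : (2 * a * B * Real.exp (t * Δ)) ^ 2
      = 4 * (a * μ / Real.exp 1 * noiseFloor t B μ Δ a) := by
    rw [← sq_noise_eq_mul_noiseFloor hμ.ne']
    ring
  have hrate := h.rate_lt_of_noiseFloor_lt hFB
  have hF₀ : 0 ≤ noiseFloor t B μ Δ a := by
    rw [noiseFloor]
    positivity
  rw [hnoise] at hP
  set s := Real.exp (t * Δ)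
  set r := a * μ / Real.exp 1
  have : 0 < r := by positivity
  have hsr : s * r ≤ 0.028 := by
    have he_sq : 7.38 ≤ Real.exp 1 ^ 2 := by nlinarith
    have hmul : 7.38 * (s * 5 * r) ≤ Real.exp 1 ^ 2 * (s * s * r) := by gcongr
    linarith
  have hnoise_le : s * r * noiseFloor t B μ Δ a ≤ 0.028 * noiseFloor t B μ Δ a := by gcongr
  have hp_one : p / 2 ^ i * D (n₀ + i) ≤ 1 * D (n₀ + i) := by
    gcongr
    exact div_le_one_of_le₀ hpi (by positivity)
  have hconst : 5 * D (n₀ + i) ≤ 2 * Real.exp 1 * D (n₀ + i) := by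
    gcongr
    linarith
  linarith

theorem dist_succ_le_noiseFloor_or_contract (h : DescentBounds D P α lam t B μ Δ)
    (hlam : 1 - lam ≤ 0.185) {n₀ i n : ℕ} (hn : n₀ + i = n) {p : ℝ} (hp₀ : 0 ≤ p)
    (hp : p ≤ Real.exp (t * Δ)) (hpi : p ≤ 2 ^ i) (hstart : P n₀ ≤ (2 + p) * D n₀)
    (hα₀ : ∀ j < i, 0 ≤ α (n₀ + j)) (hα : ∀ j < i, α (n₀ + j) ≤ 2 * α n) (ha : 0 < α n)
    (hFB : noiseFloor t B μ Δ (α n) < B ^ 2 / μ ^ 2) :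
    D (n + 1) ≤ noiseFloor t B μ Δ (α n) ∨
      D (n + 1) ≤ (1 - α n * μ / Real.exp 1) * D n
        + α n * μ / Real.exp 1 * noiseFloor t B μ Δ (α n) := by
  have hμ := h.pos_mu
  rcases le_or_gt (2 * Δ / μ) (noiseFloor t B μ Δ (α n)) with hFΔ | hFΔ
  · exact .inl ((h.dist_le_range_div _).trans hFΔ)
  rcases le_or_gt (D n) (noiseFloor t B μ Δ (α n) / 2) with hD | hD
  · left
    have hF₀ : 0 ≤ noiseFloor t B μ Δ (α n) := by linarith [h.nonneg_dist n]
    have hrate : α n * μ / Real.exp 1 * noiseFloor t B μ Δ (α n)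
        ≤ 1 / 2 * noiseFloor t B μ Δ (α n) :=
      mul_le_mul_of_nonneg_right (h.rate_le_half hFB) hF₀
    have hgrowth := h.growth n
    rw [sq_noise_eq_mul_noiseFloor hμ.ne'] at hgrowth
    linarith
  · right
    subst hn
    have hcontract := h.contract _ _ (by positivity)
      (h.weighted_le_two_exp_mul hlam hp₀ hp hpi hstart hα₀ hα ha hFB hFΔ hD)
    rwa [sq_noise_eq_mul_noiseFloor hμ.ne', mul_assoc, mul_div_mul_left _ _ two_ne_zero]
      at hcontract

theorem dist_le_max_of_const_step (h : DescentBounds D P α lam t B μ Δ) (hlam : 1 - lam ≤ 0.185)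
    (ha : 0 < a) {K : ℕ} (hα : ∀ n < K, α n = a) :
    ∀ n ≤ K, D n ≤ max (D 0) (noiseFloor t B μ Δ a) := by
  intro n hn
  induction n with
  | zero => exact le_max_left _ _
  | succ n ih =>
    have hD := ih (by omega)
    rcases le_or_gt (B ^ 2 / μ ^ 2) (noiseFloor t B μ Δ a) with hFB | hFB
    · exact ((h.dist_le_sq_div _).trans hFB).trans (le_max_right _ _)
    have hαn := hα n hn
    have hstart : P 0 ≤ (2 + 0) * D 0 := by linarith [h.weighted_zero_le, h.nonneg_dist 0]
    have hstep := h.dist_succ_le_noiseFloor_or_contract hlam (zero_add n) le_rfl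
      (Real.exp_pos _).le (by positivity) hstart
      (fun j hj => by rw [zero_add, hα j (by omega)]; exact ha.le)
      (fun j hj => by rw [zero_add, hα j (by omega), hαn]; linarith) (hαn ▸ ha) (hαn.symm ▸ hFB)
    rw [hαn] at hstep
    rcases hstep with hfloor | hcontract
    · exact hfloor.trans (le_max_right _ _)
    have hr₀ : 0 ≤ a * μ / Real.exp 1 := by
      have := h.pos_mu
      positivity
    have hr₁ : 0 ≤ 1 - a * μ / Real.exp 1 := by linarith [h.rate_le_half hFB]
    calc D (n + 1) ≤ _ := hcontract
      _ ≤ (1 - a * μ / Real.exp 1) * max (D 0) (noiseFloor t B μ Δ a)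
          + a * μ / Real.exp 1 * max (D 0) (noiseFloor t B μ Δ a) := by
        gcongr
        exact le_max_right _ _
      _ = max (D 0) (noiseFloor t B μ Δ a) := by ring

theorem exp_le_two_pow_half (h : DescentBounds D P α lam t B μ Δ) {n : ℕ}
    (hF : noiseFloor t B μ Δ (2 * Real.exp 1 / (μ * (n + 1))) < B ^ 2 / μ ^ 2) :
    Real.exp (t * Δ) ≤ 2 ^ (n - n / 2) := by
  have hμ := h.pos_mu
  have hs := h.one_le_exp
  have he : 7 ≤ Real.exp 1 ^ 2 := by nlinarith [Real.exp_one_gt_d9]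
  have hrate := h.rate_lt_of_noiseFloor_lt hF
  have hr : 2 * Real.exp 1 / (μ * (n + 1)) * μ / Real.exp 1 = 2 / ((n : ℝ) + 1) := by field_simp
  rw [hr, mul_div_assoc', div_lt_one (by positivity)] at hrate
  have hn : (n : ℝ) ≤ 2 * (n - n / 2 : ℕ) := by exact_mod_cast (by omega)
  have hpow : ((n - n / 2 : ℕ) : ℝ) ≤ 2 ^ (n - n / 2) := by
    exact_mod_cast Nat.lt_two_pow_self.le
  nlinarith

theorem dist_succ_le_of_harmonic_step (h : DescentBounds D P α lam t B μ Δ)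
    (hlam : 1 - lam ≤ 0.185) (hα₀ : ∀ n, 0 ≤ α n)
    (hα : ∀ n, α n ≤ 2 * Real.exp 1 / (μ * (n + 1))) {V : ℝ}
    (hV : 4 * B ^ 2 * Real.exp (2 + 2 * t * Δ) / μ ^ 2 ≤ V) {n : ℕ}
    (hαn : α n = 2 * Real.exp 1 / (μ * (n + 1))) (hDn : D n ≤ V / (n + 1)) :
    D (n + 1) ≤ V / (n + 1 + 1) := by
  have hμ := h.pos_mu
  have hV₀ : 0 ≤ V := le_trans (by positivity) hV
  have hfloor : noiseFloor t B μ Δ (α n) ≤ V / (2 * (n + 1)) := by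
    rw [hαn, noiseFloor_two_exp_one_div]
    gcongr
  have hsucc : V / (2 * (n + 1)) ≤ V / (n + 1 + 1) := by
    gcongr
    linarith
  rcases le_or_gt (B ^ 2 / μ ^ 2) (noiseFloor t B μ Δ (α n)) with hFB | hFB
  · exact ((h.dist_le_sq_div _).trans hFB).trans (hfloor.trans hsucc)
  have hαj (j : ℕ) : α (n / 2 + j) ≤ 2 * α n := by
    have hj : (n : ℝ) + 1 ≤ 2 * ((n / 2 + j : ℕ) + 1) := by exact_mod_cast (by omega)
    refine (hα _).trans ?_
    rw [hαn, mul_div_assoc', div_le_div_iff₀ (by positivity) (by positivity)]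
    nlinarith [mul_le_mul_of_nonneg_left hj (mul_pos (Real.exp_pos 1) hμ).le]
  rcases h.dist_succ_le_noiseFloor_or_contract hlam (by omega : n / 2 + (n - n / 2) = n)
    (Real.exp_pos _).le le_rfl (h.exp_le_two_pow_half (hαn ▸ hFB))
    ((h.weighted_le _).trans (by linarith [h.nonneg_dist (n / 2)])) (fun j _ => hα₀ _)
    (fun j _ => hαj j) (hαn ▸ by positivity) hFB with hD | hD
  · exact hD.trans (hfloor.trans hsucc)
  have hr : α n * μ / Real.exp 1 = 2 / (n + 1) := by
    rw [hαn]
    field_simp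
  have hr₁ := h.rate_le_half hFB
  rw [hr] at hD hr₁
  have hr₀ : 0 ≤ 1 - 2 / ((n : ℝ) + 1) := by linarith
  calc D (n + 1) ≤ _ := hD
    _ ≤ (1 - 2 / (n + 1)) * (V / (n + 1)) + 2 / (n + 1) * (V / (2 * (n + 1))) := by gcongr
    _ ≤ V / (n + 1 + 1) := harmonic_contraction_le hV₀ (by positivity)

theorem dist_le_div_of_harmonic_step (h : DescentBounds D P α lam t B μ Δ)
    (hlam : 1 - lam ≤ 0.185) (hα₀ : ∀ n, 0 ≤ α n)
    (hα : ∀ n, α n ≤ 2 * Real.exp 1 / (μ * (n + 1))) {K : ℕ}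
    (hαK : ∀ n, K ≤ n → α n = 2 * Real.exp 1 / (μ * (n + 1))) {V : ℝ} (hVK : (K + 1) * D K ≤ V)
    (hV : 4 * B ^ 2 * Real.exp (2 + 2 * t * Δ) / μ ^ 2 ≤ V) :
    ∀ n, K ≤ n → D n ≤ V / (n + 1) := by
  intro n hn
  induction n, hn using Nat.le_induction with
  | base =>
    rw [le_div_iff₀ (by positivity)]
    linarith
  | succ n hn ih =>
    push_cast
    exact h.dist_succ_le_of_harmonic_step hlam hα₀ hα hV (hαK n hn) ih

end DescentBounds

end Recursion

section StrongConvexity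

open Filter Topology

variable {E : Type*} [NormedAddCommGroup E] {s : Set E} {μ : ℝ} {R : E → ℝ} {x y g : E}

theorem sub_le_mul_of_strongConvexOn [NormedSpace ℝ E] (hR : StrongConvexOn s μ R) (hx : x ∈ s)
    (hy : y ∈ s) {τ : ℝ} (hτ : τ ∈ Set.Ioo (0 : ℝ) 1) :
    R (x + τ • (y - x)) - R x ≤ τ * (R y - R x - (1 - τ) * (μ / 2 * ‖x - y‖ ^ 2)) := by
  have hconv := hR.2 hx hy (sub_nonneg.2 hτ.2.le) hτ.1.le (by ring)
  rw [show (1 - τ) • x + τ • y = x + τ • (y - x) by module] at hconv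
  simp only [smul_eq_mul] at hconv
  linarith

theorem tendsto_one_sub_mul_nhdsGT_zero (a : ℝ) :
    Tendsto (fun τ : ℝ => (1 - τ) * a) (𝓝[>] 0) (𝓝 a) := by
  have hcont : Continuous fun τ : ℝ => (1 - τ) * a := by fun_prop
  simpa using (hcont.tendsto 0).mono_left nhdsWithin_le_nhds

theorem add_le_inner_of_strongConvexOn [InnerProductSpace ℝ E] [CompleteSpace E]
    (hR : StrongConvexOn s μ R) (hx : x ∈ s) (hy : y ∈ s) (hg : HasGradientAt R g x) :
    R x - R y + μ / 2 * ‖x - y‖ ^ 2 ≤ inner ℝ g (x - y) := by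
  have hline : HasDerivAt (fun τ : ℝ => R (x + τ • (y - x))) (inner ℝ g (y - x)) 0 := by
    have hsegment : HasDerivAt (fun τ : ℝ => x + τ • (y - x)) (y - x) 0 := by
      simpa using ((hasDerivAt_id (0 : ℝ)).smul_const (y - x)).const_add x
    have hfderiv : HasFDerivAt R (InnerProductSpace.toDual ℝ E g) (x + (0 : ℝ) • (y - x)) := by
      simpa using hg.hasFDerivAt
    simpa [Function.comp_def] using hfderiv.comp_hasDerivAt (0 : ℝ) hsegment
  have hbound := (tendsto_one_sub_mul_nhdsGT_zero (μ / 2 * ‖x - y‖ ^ 2)).const_sub (R y - R x)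
  have hle : inner ℝ g (y - x) ≤ R y - R x - μ / 2 * ‖x - y‖ ^ 2 := by
    refine le_of_tendsto_of_tendsto hline.tendsto_slope_zero_right hbound ?_
    filter_upwards [Ioo_mem_nhdsGT one_pos] with τ hτ
    simp only [zero_add, zero_smul, add_zero, smul_eq_mul]
    rw [inv_mul_le_iff₀ hτ.1]
    exact sub_le_mul_of_strongConvexOn hR hx hy hτ
  have hneg : inner ℝ g (x - y) = -inner ℝ g (y - x) := by rw [← inner_neg_right, neg_sub]
  linarith

theorem sq_norm_sub_le_sub_of_isMinOn [NormedSpace ℝ E] (hR : StrongConvexOn s μ R) (hx : x ∈ s)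
    (hy : y ∈ s) (hmin : IsMinOn R s y) : μ / 2 * ‖x - y‖ ^ 2 ≤ R x - R y := by
  refine le_of_tendsto (tendsto_one_sub_mul_nhdsGT_zero _) ?_
  filter_upwards [Ioo_mem_nhdsGT one_pos] with τ hτ
  have hmem : y + τ • (x - y) ∈ s := hR.1.add_smul_sub_mem hy hx ⟨hτ.1.le, hτ.2.le⟩
  have hgrowth := sub_le_mul_of_strongConvexOn hR hy hx hτ
  have hnonneg := nonneg_of_mul_nonneg_right ((sub_nonneg.2 (hmin hmem)).trans hgrowth) hτ.1
  rw [norm_sub_rev] at hnonneg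
  linarith

theorem mul_sq_norm_sub_le_inner_of_isMinOn [InnerProductSpace ℝ E] [CompleteSpace E]
    (hR : StrongConvexOn s μ R) (hx : x ∈ s) (hy : y ∈ s) (hmin : IsMinOn R s y)
    (hg : HasGradientAt R g x) : μ * ‖x - y‖ ^ 2 ≤ inner ℝ g (x - y) := by
  linarith [add_le_inner_of_strongConvexOn hR hx hy hg, sq_norm_sub_le_sub_of_isMinOn hR hx hy hmin]

end StrongConvexity

section UniformSampling

variable {Ω ι α : Type*} [MeasurableSpace Ω] {P : Measure Ω} [Fintype ι] [Nonempty ι]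
  [MeasurableSpace ι] [MeasurableSingletonClass ι] [MeasurableSpace α] {X : Ω → α} {Z : Ω → ι}

theorem integral_indicator_uniform (hZ : Measurable Z)
    (hu : P.map Z = (PMF.uniformOfFintype ι).toMeasure) (i : ι) :
    ∫ ω, ({i} : Set ι).indicator (1 : ι → ℝ) (Z ω) ∂P = (Fintype.card ι : ℝ)⁻¹ := by
  have hmeas : Measurable (({i} : Set ι).indicator (1 : ι → ℝ)) :=
    measurable_one.indicator (measurableSet_singleton i)
  rw [← integral_map hZ.aemeasurable hmeas.aestronglyMeasurable, hu,
    integral_indicator_one (measurableSet_singleton i), Measure.real,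
    PMF.toMeasure_apply_singleton _ _ (measurableSet_singleton i)]
  simp

theorem integral_comp_uniform (hX : Measurable X) (hZ : Measurable Z)
    (hu : P.map Z = (PMF.uniformOfFintype ι).toMeasure) (hind : IndepFun X Z P)
    {G : ι → α → ℝ} (hG : ∀ i, Measurable (G i)) (hint : ∀ i, Integrable (fun ω => G i (X ω)) P) :
    Integrable (fun ω => G (Z ω) (X ω)) P ∧
      ∫ ω, G (Z ω) (X ω) ∂P = ∫ ω, 𝔼 i, G i (X ω) ∂P := by
  classical
  have hsum : (fun ω => G (Z ω) (X ω)) =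
      fun ω => ∑ i, G i (X ω) * ({i} : Set ι).indicator 1 (Z ω) := by
    funext ω
    simp [Set.indicator_apply]
  have hmeas (i : ι) : Measurable (({i} : Set ι).indicator (1 : ι → ℝ)) :=
    measurable_one.indicator (measurableSet_singleton i)
  have hterm (i : ι) :
      Integrable (fun ω => G i (X ω) * ({i} : Set ι).indicator (1 : ι → ℝ) (Z ω)) P := by
    refine (hint i).mul_bdd (c := 1) ((hmeas i).comp hZ).aestronglyMeasurable
      (Filter.Eventually.of_forall fun ω => ?_)
    by_cases h : Z ω = i <;> simp [Set.indicator, h]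
  rw [hsum]
  refine ⟨integrable_finsetSum _ fun i _ => hterm i, ?_⟩
  simp only [Fintype.expect_eq_sum_div_card]
  rw [integral_finsetSum _ fun i _ => hterm i, integral_div,
    integral_finsetSum _ fun i _ => hint i, Finset.sum_div]
  refine Finset.sum_congr rfl fun i _ => ?_
  rw [hind.integral_fun_comp_mul_comp hX.aemeasurable hZ.aemeasurable
    (hG i).aestronglyMeasurable (hmeas i).aestronglyMeasurable, integral_indicator_uniform hZ hu,
    div_eq_mul_inv]

end UniformSampling

theorem sq_norm_le_of_norm_sub_le {E : Type*} [SeminormedAddCommGroup E] {a b : E} {δ : ℝ}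
    (h : ‖a - b‖ ≤ δ) : ‖a‖ ^ 2 ≤ 5 / 4 * ‖b‖ ^ 2 + 5 * δ ^ 2 := by
  have htri : ‖a‖ ≤ ‖b‖ + δ := by linarith [norm_le_norm_add_norm_sub' a b]
  nlinarith [norm_nonneg a, norm_nonneg b, sq_nonneg (‖b‖ / 2 - 2 * δ), norm_nonneg (a - b)]

theorem two_div_sub_div_sq_le_inv {ρ r : ℝ} (hρ : 0 < ρ) (hr : r ≠ 0) :
    2 / r - ρ / r ^ 2 ≤ ρ⁻¹ := by
  have hsq : ρ⁻¹ - (2 / r - ρ / r ^ 2) = ρ⁻¹ * (1 - ρ / r) ^ 2 := by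
    field_simp
    ring
  have hnonneg : 0 ≤ ρ⁻¹ * (1 - ρ / r) ^ 2 := by positivity
  linarith

section Weights

variable {E ι : Type*} [Fintype ι]

/-- The average of the weights `c i θ` over the sample index `i`. -/
def meanWeight (c : ι → E → ℝ) (θ : E) : ℝ :=
  𝔼 i, c i θ

variable [NormedAddCommGroup E] [InnerProductSpace ℝ E] [MeasurableSpace E]

/-- What the analysis of the solver uses about the exponential weights `c i` and the unnormalized
gradients `w i` on the domain `Θ`, with `θs` the minimizer, `m` the least possible weight, tilt `t`,
gradient bound `B`, convexity modulus `μ` and loss range `Δ`. -/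
structure WeightBounds (Θ : Set E) (θs : E) (c : ι → E → ℝ) (w : ι → E → E) (m t B μ Δ : ℝ) :
    Prop where
  pos_m : 0 < m
  pos_t : 0 < t
  pos_mu : 0 < μ
  nonneg_B : 0 ≤ B
  measurable_weight : ∀ i, Measurable (c i)
  measurable_grad : ∀ i, Measurable (w i)
  weight_mem : ∀ i, ∀ θ ∈ Θ, c i θ ∈ Set.Icc m (Real.exp (t * Δ) * m)
  norm_grad_le : ∀ i, ∀ θ ∈ Θ, ‖w i θ‖ ≤ B * meanWeight c θ
  le_expect_inner : ∀ θ ∈ Θ,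
    μ * meanWeight c θ * ‖θ - θs‖ ^ 2 ≤ 𝔼 i, inner ℝ (w i θ) (θ - θs)
  meanWeight_le : ∀ θ ∈ Θ, ∀ θ' ∈ Θ,
    meanWeight c θ ≤ Real.exp (t * B * ‖θ - θ'‖) * meanWeight c θ'
  sq_norm_sub_le : ∀ θ ∈ Θ, ‖θ - θs‖ ^ 2 ≤ 2 * Δ / μ

theorem div_mem_Icc_of_mem_Icc {a b m s : ℝ} (hm : 0 < m) (ha : a ∈ Set.Icc m (s * m))
    (hb : b ∈ Set.Icc m (s * m)) : a / b ∈ Set.Icc 0 s := by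
  have hs : 0 ≤ s := by
    by_contra! hneg
    nlinarith [ha.1, ha.2]
  refine ⟨div_nonneg (hm.le.trans ha.1) (hm.le.trans hb.1), ?_⟩
  rw [div_le_iff₀ (hm.trans_le hb.1)]
  exact ha.2.trans (mul_le_mul_of_nonneg_left hb.1 hs)

namespace WeightBounds

variable {Θ : Set E} {θs θ : E} {c : ι → E → ℝ} {w : ι → E → E} {m t B μ Δ : ℝ}

theorem measurable_meanWeight (W : WeightBounds Θ θs c w m t B μ Δ) :
    Measurable (meanWeight c) := by
  have hmean : meanWeight c = fun θ => (∑ i, c i θ) / Fintype.card ι :=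
    funext fun _ => Fintype.expect_eq_sum_div_card _
  rw [hmean]
  exact (Finset.measurable_fun_sum _ fun i _ => W.measurable_weight i).div_const _

variable [Nonempty ι]

theorem meanWeight_mem (W : WeightBounds Θ θs c w m t B μ Δ) (hθ : θ ∈ Θ) :
    meanWeight c θ ∈ Set.Icc m (Real.exp (t * Δ) * m) :=
  ⟨Finset.le_expect Finset.univ_nonempty fun i _ => (W.weight_mem i θ hθ).1,
    Finset.expect_le Finset.univ_nonempty fun i _ => (W.weight_mem i θ hθ).2⟩

theorem meanWeight_pos (W : WeightBounds Θ θs c w m t B μ Δ) (hθ : θ ∈ Θ) :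
    0 < meanWeight c θ :=
  W.pos_m.trans_le (W.meanWeight_mem hθ).1

theorem norm_sub_le (W : WeightBounds Θ θs c w m t B μ Δ) (hθ : θ ∈ Θ) :
    ‖θ - θs‖ ≤ B / μ := by
  have hmean : μ * meanWeight c θ * ‖θ - θs‖ ^ 2 ≤ B * meanWeight c θ * ‖θ - θs‖ :=
    (W.le_expect_inner θ hθ).trans <| Finset.expect_le Finset.univ_nonempty fun i _ =>
      (real_inner_le_norm _ _).trans (by gcongr; exact W.norm_grad_le i θ hθ)
  rw [le_div_iff₀ W.pos_mu]
  rcases (norm_nonneg (θ - θs)).eq_or_lt with hzero | hpos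
  · simpa [← hzero] using W.nonneg_B
  · have hc := W.meanWeight_pos hθ
    exact le_of_mul_le_mul_right (by linarith) (mul_pos hc hpos)

theorem norm_inner_div_le (W : WeightBounds Θ θs c w m t B μ Δ) (i : ι) (hθ : θ ∈ Θ) {v : ℝ}
    (hv : v ∈ Set.Icc m (Real.exp (t * Δ) * m)) :
    ‖inner ℝ (w i θ) (θ - θs) / v‖ ≤ B * Real.exp (t * Δ) * (B / μ) := by
  have hv₀ : 0 < v := W.pos_m.trans_le hv.1
  have hB := W.nonneg_B
  have hratio := div_mem_Icc_of_mem_Icc W.pos_m (W.meanWeight_mem hθ) hv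
  rw [norm_div, Real.norm_of_nonneg hv₀.le]
  calc ‖inner ℝ (w i θ) (θ - θs)‖ / v
      ≤ B * meanWeight c θ * ‖θ - θs‖ / v := by
        gcongr
        exact (norm_inner_le_norm _ _).trans (by gcongr; exact W.norm_grad_le i θ hθ)
    _ = B * (meanWeight c θ / v) * ‖θ - θs‖ := by ring
    _ ≤ B * Real.exp (t * Δ) * (B / μ) := by
        gcongr
        exacts [hratio.2, W.norm_sub_le hθ]

theorem div_meanWeight_le (W : WeightBounds Θ θs c w m t B μ Δ) {θ' : E} (hθ : θ ∈ Θ)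
    (hθ' : θ' ∈ Θ) {v δ : ℝ} (hv : 0 ≤ v) (hδ : ‖θ' - θ‖ ≤ δ) :
    v / meanWeight c θ' ≤ Real.exp (t * B * δ) * (v / meanWeight c θ) := by
  have hle : meanWeight c θ ≤ Real.exp (t * B * δ) * meanWeight c θ' := by
    have htB := mul_nonneg W.pos_t.le W.nonneg_B
    have hc' := W.meanWeight_pos hθ'
    refine (W.meanWeight_le θ hθ θ' hθ').trans ?_
    rw [norm_sub_rev]
    gcongr
  rw [← mul_div_assoc, div_le_div_iff₀ (W.meanWeight_pos hθ') (W.meanWeight_pos hθ)]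
  linarith [mul_le_mul_of_nonneg_left hle hv]

theorem sq_dist_mul_div_le (W : WeightBounds Θ θs c w m t B μ Δ) {θ' : E} (hθ : θ ∈ Θ)
    (hθ' : θ' ∈ Θ) {v δ : ℝ} (hv : v ∈ Set.Icc m (Real.exp (t * Δ) * m)) (hδ : ‖θ' - θ‖ ≤ δ) :
    ‖θ' - θs‖ ^ 2 * (v / meanWeight c θ') ≤ Real.exp (t * B * δ) *
      (5 / 4 * (‖θ - θs‖ ^ 2 * (v / meanWeight c θ)) + 5 * Real.exp (t * Δ) * δ ^ 2) := by
  have hv₀ : 0 < v := W.pos_m.trans_le hv.1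
  have hc' := W.meanWeight_pos hθ'
  have hdist : ‖θ' - θs‖ ^ 2 ≤ 5 / 4 * ‖θ - θs‖ ^ 2 + 5 * δ ^ 2 :=
    sq_norm_le_of_norm_sub_le (by rwa [sub_sub_sub_cancel_right])
  have hratio := div_mem_Icc_of_mem_Icc W.pos_m hv (W.meanWeight_mem hθ)
  calc ‖θ' - θs‖ ^ 2 * (v / meanWeight c θ')
      ≤ (5 / 4 * ‖θ - θs‖ ^ 2 + 5 * δ ^ 2) *
          (Real.exp (t * B * δ) * (v / meanWeight c θ)) := by
        gcongr
        exact W.div_meanWeight_le hθ hθ' hv₀.le hδ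
    _ = Real.exp (t * B * δ) * (5 / 4 * (‖θ - θs‖ ^ 2 * (v / meanWeight c θ))
          + 5 * (v / meanWeight c θ) * δ ^ 2) := by ring
    _ ≤ _ := by
        gcongr
        exact hratio.2

end WeightBounds

end Weights

section SolverRun

variable {Ω E ι : Type*} [MeasurableSpace Ω] [NormedAddCommGroup E] [InnerProductSpace ℝ E]
  [MeasurableSpace E] [Fintype ι] [MeasurableSpace ι]

/-- A run of the solver in the domain `Θ`: parameters `y n`, exponentiated normalizer estimates
`u n`, averaging parameter `lam`, step sizes `α n`, and samples `ζ n` for the gradient and `ξ n` for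
the normalizer. The estimate `u (n + 1)` is the one used in the step from `y n` to `y (n + 1)`. -/
structure SolverRun [Nonempty ι] (P : Measure Ω) (Θ : Set E) (c : ι → E → ℝ) (w : ι → E → E)
    (lam : ℝ) (α : ℕ → ℝ) (y : ℕ → Ω → E) (u : ℕ → Ω → ℝ) (ζ ξ : ℕ → Ω → ι) : Prop where
  lam_mem : lam ∈ Set.Icc (0 : ℝ) 1
  nonneg_step : ∀ n, 0 ≤ α n
  measurable_param : ∀ n, Measurable (y n)
  measurable_normalizer : ∀ n, Measurable (u n)
  measurable_gradSample : ∀ n, Measurable (ζ n)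
  measurable_normSample : ∀ n, Measurable (ξ n)
  gradSample_uniform : ∀ n, P.map (ζ n) = (PMF.uniformOfFintype ι).toMeasure
  normSample_uniform : ∀ n, P.map (ξ n) = (PMF.uniformOfFintype ι).toMeasure
  indep_gradSample : ∀ n, IndepFun (fun ω => (y n ω, u (n + 1) ω)) (ζ n) P
  indep_normSample : ∀ n, IndepFun (y n) (ξ n) P
  normalizer_zero : ∀ ω, u 0 ω = meanWeight c (y 0 ω)
  normalizer_succ : ∀ n ω, u (n + 1) ω = (1 - lam) * u n ω + lam * c (ξ n ω) (y n ω)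
  param_succ : ∀ n ω, y (n + 1) ω = y n ω - (α n / u (n + 1) ω) • w (ζ n ω) (y n ω)
  mem : ∀ n, ∀ᵐ ω ∂P, y n ω ∈ Θ

/-- The mean squared distance of `y` to `θs`, weighted by the ratio of the normalizer estimate `v`
to the exact normalizer at `y`. -/
def relSqDist (P : Measure Ω) (θs : E) (c : ι → E → ℝ) (y : Ω → E) (v : Ω → ℝ) : ℝ :=
  ∫ ω, ‖y ω - θs‖ ^ 2 * (v ω / meanWeight c (y ω)) ∂P

namespace SolverRun

variable [Nonempty ι] {P : Measure Ω} {Θ : Set E} {θs : E} {c : ι → E → ℝ} {w : ι → E → E}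
  {lam m t B μ Δ : ℝ} {α : ℕ → ℝ} {y : ℕ → Ω → E} {u : ℕ → Ω → ℝ} {ζ ξ : ℕ → Ω → ι}

theorem normalizer_mem (S : SolverRun P Θ c w lam α y u ζ ξ) (W : WeightBounds Θ θs c w m t B μ Δ)
    (n : ℕ) : ∀ᵐ ω ∂P, u n ω ∈ Set.Icc m (Real.exp (t * Δ) * m) := by
  induction n with
  | zero =>
    filter_upwards [S.mem 0] with ω hω
    rw [S.normalizer_zero]
    exact W.meanWeight_mem hω
  | succ n ih =>
    filter_upwards [S.mem n, ih] with ω hω hu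
    rw [S.normalizer_succ]
    exact convex_Icc _ _ hu (W.weight_mem (ξ n ω) _ hω) (sub_nonneg.2 S.lam_mem.2) S.lam_mem.1
      (sub_add_cancel _ _)

theorem normalizer_pos (S : SolverRun P Θ c w lam α y u ζ ξ) (W : WeightBounds Θ θs c w m t B μ Δ)
    (n : ℕ) : ∀ᵐ ω ∂P, 0 < u n ω :=
  (S.normalizer_mem W n).mono fun _ hu => W.pos_m.trans_le hu.1

theorem norm_step_le (S : SolverRun P Θ c w lam α y u ζ ξ) (W : WeightBounds Θ θs c w m t B μ Δ)
    (n : ℕ) : ∀ᵐ ω ∂P, ‖y (n + 1) ω - y n ω‖ ≤ α n * B * Real.exp (t * Δ) := by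
  filter_upwards [S.mem n, S.normalizer_mem W (n + 1)] with ω hω hu
  have hratio := div_mem_Icc_of_mem_Icc W.pos_m (W.meanWeight_mem hω) hu
  have hu₀ : 0 < u (n + 1) ω := W.pos_m.trans_le hu.1
  have hα := S.nonneg_step n
  have hB := W.nonneg_B
  rw [S.param_succ, sub_sub_cancel_left, norm_neg, norm_smul, Real.norm_of_nonneg (by positivity)]
  calc α n / u (n + 1) ω * ‖w (ζ n ω) (y n ω)‖
      ≤ α n / u (n + 1) ω * (B * meanWeight c (y n ω)) := by
        gcongr
        exact W.norm_grad_le _ _ hω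
    _ = α n * B * (meanWeight c (y n ω) / u (n + 1) ω) := by ring
    _ ≤ α n * B * Real.exp (t * Δ) := by
        gcongr
        exact hratio.2

variable [IsProbabilityMeasure P] [BorelSpace E]

theorem integrable_sq_dist (S : SolverRun P Θ c w lam α y u ζ ξ)
    (W : WeightBounds Θ θs c w m t B μ Δ) (n : ℕ) : Integrable (fun ω => ‖y n ω - θs‖ ^ 2) P := by
  refine Integrable.of_mem_Icc 0 (2 * Δ / μ)
    (((S.measurable_param n).sub_const _).norm.pow_const 2).aemeasurable ?_
  filter_upwards [S.mem n] with ω hω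
  exact ⟨by positivity, W.sq_norm_sub_le _ hω⟩

theorem integrable_sq_dist_mul (S : SolverRun P Θ c w lam α y u ζ ξ)
    (W : WeightBounds Θ θs c w m t B μ Δ) (n : ℕ) {ρ : Ω → ℝ} (hρ : Measurable ρ) {s : ℝ}
    (hmem : ∀ᵐ ω ∂P, ρ ω ∈ Set.Icc 0 s) : Integrable (fun ω => ‖y n ω - θs‖ ^ 2 * ρ ω) P := by
  refine (S.integrable_sq_dist W n).mul_bdd (c := s) hρ.aestronglyMeasurable ?_
  filter_upwards [hmem] with ω hω
  rw [Real.norm_of_nonneg hω.1]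
  exact hω.2

theorem integrable_relSqDist (S : SolverRun P Θ c w lam α y u ζ ξ)
    (W : WeightBounds Θ θs c w m t B μ Δ) (n k : ℕ) :
    Integrable (fun ω => ‖y n ω - θs‖ ^ 2 * (u k ω / meanWeight c (y n ω))) P := by
  refine S.integrable_sq_dist_mul W n (s := Real.exp (t * Δ))
    ((S.measurable_normalizer k).div (W.measurable_meanWeight.comp (S.measurable_param n))) ?_
  filter_upwards [S.mem n, S.normalizer_mem W k] with ω hω hu
  exact div_mem_Icc_of_mem_Icc W.pos_m hu (W.meanWeight_mem hω)

theorem integrable_sq_dist_mul_div (S : SolverRun P Θ c w lam α y u ζ ξ)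
    (W : WeightBounds Θ θs c w m t B μ Δ) (n k : ℕ) :
    Integrable (fun ω => ‖y n ω - θs‖ ^ 2 * (meanWeight c (y n ω) / u k ω)) P := by
  refine S.integrable_sq_dist_mul W n (s := Real.exp (t * Δ))
    ((W.measurable_meanWeight.comp (S.measurable_param n)).div (S.measurable_normalizer k)) ?_
  filter_upwards [S.mem n, S.normalizer_mem W k] with ω hω hu
  exact div_mem_Icc_of_mem_Icc W.pos_m (W.meanWeight_mem hω) hu

section NormalizerUpdate

variable [MeasurableSingletonClass ι]

theorem integral_sq_dist_mul_sampled_weight (S : SolverRun P Θ c w lam α y u ζ ξ)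
    (W : WeightBounds Θ θs c w m t B μ Δ) (n : ℕ) :
    Integrable (fun ω => ‖y n ω - θs‖ ^ 2 * (c (ξ n ω) (y n ω) / meanWeight c (y n ω))) P ∧
      ∫ ω, ‖y n ω - θs‖ ^ 2 * (c (ξ n ω) (y n ω) / meanWeight c (y n ω)) ∂P
        = ∫ ω, ‖y n ω - θs‖ ^ 2 ∂P := by
  have hc := W.measurable_meanWeight
  have hci := W.measurable_weight
  have hy := S.measurable_param n
  have hint (i : ι) :
      Integrable (fun ω => ‖y n ω - θs‖ ^ 2 * (c i (y n ω) / meanWeight c (y n ω))) P := by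
    refine S.integrable_sq_dist_mul W n (s := Real.exp (t * Δ)) (by fun_prop) ?_
    filter_upwards [S.mem n] with ω hω
    exact div_mem_Icc_of_mem_Icc W.pos_m (W.weight_mem i _ hω) (W.meanWeight_mem hω)
  obtain ⟨hsampled, heq⟩ := integral_comp_uniform hy (S.measurable_normSample n)
    (S.normSample_uniform n) (S.indep_normSample n)
    (G := fun i θ => ‖θ - θs‖ ^ 2 * (c i θ / meanWeight c θ)) (fun i => by fun_prop) hint
  refine ⟨hsampled, heq.trans (integral_congr_ae ?_)⟩
  filter_upwards [S.mem n] with ω hω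
  rw [← Finset.mul_expect, ← Finset.expect_div]
  change _ * (meanWeight c (y n ω) / meanWeight c (y n ω)) = _
  rw [div_self (W.meanWeight_pos hω).ne', mul_one]

theorem relSqDist_succ (S : SolverRun P Θ c w lam α y u ζ ξ)
    (W : WeightBounds Θ θs c w m t B μ Δ) (n : ℕ) :
    relSqDist P θs c (y n) (u (n + 1)) = (1 - lam) * relSqDist P θs c (y n) (u n)
      + lam * ∫ ω, ‖y n ω - θs‖ ^ 2 ∂P := by
  obtain ⟨hsampled, heq⟩ := S.integral_sq_dist_mul_sampled_weight W n
  rw [← heq, relSqDist, relSqDist, ← integral_const_mul, ← integral_const_mul,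
    ← integral_add ((S.integrable_relSqDist W n n).const_mul _) (hsampled.const_mul _)]
  refine integral_congr_ae (Filter.Eventually.of_forall fun ω => ?_)
  simp only [S.normalizer_succ]
  ring

theorem relSqDist_zero (S : SolverRun P Θ c w lam α y u ζ ξ)
    (W : WeightBounds Θ θs c w m t B μ Δ) :
    relSqDist P θs c (y 0) (u 1) = ∫ ω, ‖y 0 ω - θs‖ ^ 2 ∂P := by
  have hexact : relSqDist P θs c (y 0) (u 0) = ∫ ω, ‖y 0 ω - θs‖ ^ 2 ∂P := by
    refine integral_congr_ae ?_
    filter_upwards [S.mem 0] with ω hω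
    rw [S.normalizer_zero, div_self (W.meanWeight_pos hω).ne', mul_one]
  rw [S.relSqDist_succ W, hexact]
  ring

end NormalizerUpdate

theorem relSqDist_mem (S : SolverRun P Θ c w lam α y u ζ ξ)
    (W : WeightBounds Θ θs c w m t B μ Δ) (n k : ℕ) :
    relSqDist P θs c (y n) (u k) ∈
      Set.Icc 0 (Real.exp (t * Δ) * ∫ ω, ‖y n ω - θs‖ ^ 2 ∂P) := by
  have hratio : ∀ᵐ ω ∂P, u k ω / meanWeight c (y n ω) ∈ Set.Icc 0 (Real.exp (t * Δ)) := by
    filter_upwards [S.mem n, S.normalizer_mem W k] with ω hω hu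
    exact div_mem_Icc_of_mem_Icc W.pos_m hu (W.meanWeight_mem hω)
  constructor
  · refine integral_nonneg_of_ae ?_
    filter_upwards [hratio] with ω hω
    exact mul_nonneg (by positivity) hω.1
  · rw [mul_comm, ← integral_mul_const]
    refine integral_mono_ae (S.integrable_relSqDist W n k)
      ((S.integrable_sq_dist W n).mul_const _) ?_
    filter_upwards [hratio] with ω hω
    exact mul_le_mul_of_nonneg_left hω.2 (by positivity)

theorem integral_sq_dist_le (S : SolverRun P Θ c w lam α y u ζ ξ)
    (W : WeightBounds Θ θs c w m t B μ Δ) (n : ℕ) {b : ℝ}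
    (hb : ∀ θ ∈ Θ, ‖θ - θs‖ ^ 2 ≤ b) : ∫ ω, ‖y n ω - θs‖ ^ 2 ∂P ≤ b := by
  have hle := integral_mono_ae (S.integrable_sq_dist W n) (integrable_const b)
    ((S.mem n).mono fun ω hω => hb _ hω)
  simpa using hle

theorem integral_sq_dist_le_succ (S : SolverRun P Θ c w lam α y u ζ ξ)
    (W : WeightBounds Θ θs c w m t B μ Δ) (n : ℕ) :
    ∫ ω, ‖y n ω - θs‖ ^ 2 ∂P ≤ 5 / 4 * ∫ ω, ‖y (n + 1) ω - θs‖ ^ 2 ∂P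
      + 5 * (α n * B * Real.exp (t * Δ)) ^ 2 := by
  have hint := (S.integrable_sq_dist W (n + 1)).const_mul (5 / 4)
  calc ∫ ω, ‖y n ω - θs‖ ^ 2 ∂P
      ≤ ∫ ω, 5 / 4 * ‖y (n + 1) ω - θs‖ ^ 2 + 5 * (α n * B * Real.exp (t * Δ)) ^ 2 ∂P := by
        refine integral_mono_ae (S.integrable_sq_dist W n) (hint.add (integrable_const _)) ?_
        filter_upwards [S.norm_step_le W n] with ω hstep
        refine sq_norm_le_of_norm_sub_le ?_
        rwa [sub_sub_sub_cancel_right, norm_sub_rev]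
    _ = _ := by
        rw [integral_add hint (integrable_const _), integral_const_mul]
        simp

theorem relSqDist_drift (S : SolverRun P Θ c w lam α y u ζ ξ)
    (W : WeightBounds Θ θs c w m t B μ Δ) (n : ℕ) :
    relSqDist P θs c (y (n + 1)) (u (n + 1)) ≤
      Real.exp (t * B * (α n * B * Real.exp (t * Δ))) *
        (5 / 4 * relSqDist P θs c (y n) (u (n + 1))
          + 5 * Real.exp (t * Δ) * (α n * B * Real.exp (t * Δ)) ^ 2) := by
  set δ := α n * B * Real.exp (t * Δ)
  have hint := (S.integrable_relSqDist W n (n + 1)).const_mul (5 / 4)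
  calc relSqDist P θs c (y (n + 1)) (u (n + 1))
      ≤ ∫ ω, Real.exp (t * B * δ) *
          (5 / 4 * (‖y n ω - θs‖ ^ 2 * (u (n + 1) ω / meanWeight c (y n ω)))
            + 5 * Real.exp (t * Δ) * δ ^ 2) ∂P := by
        refine integral_mono_ae (S.integrable_relSqDist W (n + 1) (n + 1))
          ((hint.add (integrable_const _)).const_mul _) ?_
        filter_upwards [S.mem n, S.mem (n + 1), S.norm_step_le W n, S.normalizer_mem W (n + 1)]
          with ω hω hω' hstep hu
        exact W.sq_dist_mul_div_le hω hω' hu hstep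
    _ = _ := by
        rw [integral_const_mul, integral_add hint (integrable_const _), integral_const_mul]
        simp [relSqDist]

section GradientStep

variable [SecondCountableTopology E] [MeasurableSingletonClass ι]

theorem integrable_and_le_integral_sampled_inner (S : SolverRun P Θ c w lam α y u ζ ξ)
    (W : WeightBounds Θ θs c w m t B μ Δ) (n : ℕ) :
    Integrable (fun ω => inner ℝ (w (ζ n ω) (y n ω)) (y n ω - θs) / u (n + 1) ω) P ∧
      μ * ∫ ω, ‖y n ω - θs‖ ^ 2 * (meanWeight c (y n ω) / u (n + 1) ω) ∂P
        ≤ ∫ ω, inner ℝ (w (ζ n ω) (y n ω)) (y n ω - θs) / u (n + 1) ω ∂P := by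
  have hy := S.measurable_param n
  have hu := S.measurable_normalizer (n + 1)
  have hw := W.measurable_grad
  have hG (i : ι) : Measurable fun p : E × ℝ => inner ℝ (w i p.1) (p.1 - θs) / p.2 := by fun_prop
  have hbound (i : ι) : ∀ᵐ ω ∂P, ‖inner ℝ (w i (y n ω)) (y n ω - θs) / u (n + 1) ω‖
      ≤ B * Real.exp (t * Δ) * (B / μ) := by
    filter_upwards [S.mem n, S.normalizer_mem W (n + 1)] with ω hω hmem
    exact W.norm_inner_div_le i hω hmem
  have hint (i : ι) :
      Integrable (fun ω => inner ℝ (w i (y n ω)) (y n ω - θs) / u (n + 1) ω) P :=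
    .of_bound ((hG i).comp (hy.prodMk hu)).aestronglyMeasurable _ (hbound i)
  obtain ⟨hsampled, heq⟩ := integral_comp_uniform (hy.prodMk hu) (S.measurable_gradSample n)
    (S.gradSample_uniform n) (S.indep_gradSample n) hG hint
  refine ⟨hsampled, ?_⟩
  rw [heq, ← integral_const_mul]
  refine integral_mono_ae ((S.integrable_sq_dist_mul_div W n (n + 1)).const_mul μ) ?_ ?_
  · simp only [Fintype.expect_eq_sum_div_card]
    exact (integrable_finsetSum _ fun i _ => hint i).div_const _
  · filter_upwards [S.mem n, S.normalizer_pos W (n + 1)] with ω hω hu₀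
    rw [← Finset.expect_div, le_div_iff₀ hu₀]
    refine le_trans (le_of_eq ?_) (W.le_expect_inner _ hω)
    field_simp

theorem integral_sq_dist_succ_le (S : SolverRun P Θ c w lam α y u ζ ξ)
    (W : WeightBounds Θ θs c w m t B μ Δ) (n : ℕ) :
    ∫ ω, ‖y (n + 1) ω - θs‖ ^ 2 ∂P ≤ ∫ ω, ‖y n ω - θs‖ ^ 2 ∂P
      - 2 * α n * μ * ∫ ω, ‖y n ω - θs‖ ^ 2 * (meanWeight c (y n ω) / u (n + 1) ω) ∂P
      + (α n * B * Real.exp (t * Δ)) ^ 2 := by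
  obtain ⟨hinner, hle⟩ := S.integrable_and_le_integral_sampled_inner W n
  have hX := S.integrable_sq_dist W n
  have hdescent : Integrable (fun ω => ‖y n ω - θs‖ ^ 2
      - 2 * α n * (inner ℝ (w (ζ n ω) (y n ω)) (y n ω - θs) / u (n + 1) ω)) P :=
    hX.sub (hinner.const_mul _)
  have hstep : ∫ ω, ‖y (n + 1) ω - θs‖ ^ 2 ∂P ≤ ∫ ω, ‖y n ω - θs‖ ^ 2
      - 2 * α n * (inner ℝ (w (ζ n ω) (y n ω)) (y n ω - θs) / u (n + 1) ω)
      + (α n * B * Real.exp (t * Δ)) ^ 2 ∂P := by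
    refine integral_mono_ae (S.integrable_sq_dist W (n + 1))
      (hdescent.add (integrable_const _)) ?_
    filter_upwards [S.norm_step_le W n] with ω hω
    have hsq := pow_le_pow_left₀ (norm_nonneg _) hω 2
    have hexpand : ‖y (n + 1) ω - θs‖ ^ 2 = ‖y n ω - θs‖ ^ 2
        - 2 * α n * (inner ℝ (w (ζ n ω) (y n ω)) (y n ω - θs) / u (n + 1) ω)
        + ‖y (n + 1) ω - y n ω‖ ^ 2 := by
      rw [S.param_succ, sub_right_comm, norm_sub_sq_real, real_inner_comm, real_inner_smul_left,
        sub_sub_cancel_left, norm_neg]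
      ring
    linarith
  rw [integral_add hdescent (integrable_const _), integral_sub hX (hinner.const_mul _),
    integral_const_mul, integral_const, probReal_univ, one_smul] at hstep
  have := mul_le_mul_of_nonneg_left hle (S.nonneg_step n)
  linarith

theorem integral_sq_dist_succ_le_add (S : SolverRun P Θ c w lam α y u ζ ξ)
    (W : WeightBounds Θ θs c w m t B μ Δ) (n : ℕ) :
    ∫ ω, ‖y (n + 1) ω - θs‖ ^ 2 ∂P
      ≤ ∫ ω, ‖y n ω - θs‖ ^ 2 ∂P + (α n * B * Real.exp (t * Δ)) ^ 2 := by
  have hnonneg :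
      0 ≤ ∫ ω, ‖y n ω - θs‖ ^ 2 * (meanWeight c (y n ω) / u (n + 1) ω) ∂P := by
    refine integral_nonneg_of_ae ?_
    filter_upwards [S.mem n, S.normalizer_pos W (n + 1)] with ω hω hu
    have := W.meanWeight_pos hω
    positivity
  have hα := S.nonneg_step n
  have hμ := W.pos_mu.le
  have hdecrease : 0 ≤ 2 * α n * μ *
      ∫ ω, ‖y n ω - θs‖ ^ 2 * (meanWeight c (y n ω) / u (n + 1) ω) ∂P := by positivity
  linarith [S.integral_sq_dist_succ_le W n]

theorem integral_sq_dist_contract (S : SolverRun P Θ c w lam α y u ζ ξ)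
    (W : WeightBounds Θ θs c w m t B μ Δ) (n : ℕ) {r : ℝ} (hr : 0 < r)
    (hrel : relSqDist P θs c (y n) (u (n + 1)) ≤ r * ∫ ω, ‖y n ω - θs‖ ^ 2 ∂P) :
    ∫ ω, ‖y (n + 1) ω - θs‖ ^ 2 ∂P ≤ (1 - 2 * α n * μ / r) * ∫ ω, ‖y n ω - θs‖ ^ 2 ∂P
      + (α n * B * Real.exp (t * Δ)) ^ 2 := by
  have hX := (S.integrable_sq_dist W n).const_mul (2 / r)
  have hP := (S.integrable_relSqDist W n (n + 1)).const_mul (1 / r ^ 2)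
  have hpointwise : 2 / r * ∫ ω, ‖y n ω - θs‖ ^ 2 ∂P
      - 1 / r ^ 2 * relSqDist P θs c (y n) (u (n + 1))
      ≤ ∫ ω, ‖y n ω - θs‖ ^ 2 * (meanWeight c (y n ω) / u (n + 1) ω) ∂P := by
    rw [relSqDist, ← integral_const_mul, ← integral_const_mul, ← integral_sub hX hP]
    refine integral_mono_ae (hX.sub hP) (S.integrable_sq_dist_mul_div W n (n + 1)) ?_
    filter_upwards [S.mem n, S.normalizer_pos W (n + 1)] with ω hω hu
    have hAMGM := two_div_sub_div_sq_le_inv (div_pos hu (W.meanWeight_pos hω)) hr.ne'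
    rw [inv_div] at hAMGM
    exact (le_of_eq (by ring)).trans (mul_le_mul_of_nonneg_left hAMGM (sq_nonneg ‖y n ω - θs‖))
  have hrate : 1 / r * ∫ ω, ‖y n ω - θs‖ ^ 2 ∂P
      ≤ ∫ ω, ‖y n ω - θs‖ ^ 2 * (meanWeight c (y n ω) / u (n + 1) ω) ∂P := by
    refine le_trans ?_ hpointwise
    have hscale := mul_le_mul_of_nonneg_left hrel (by positivity : 0 ≤ 1 / r ^ 2)
    have hcancel : 1 / r ^ 2 * (r * ∫ ω, ‖y n ω - θs‖ ^ 2 ∂P)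
        = 1 / r * ∫ ω, ‖y n ω - θs‖ ^ 2 ∂P := by field_simp
    have hdouble : 2 / r * ∫ ω, ‖y n ω - θs‖ ^ 2 ∂P
        = 2 * (1 / r * ∫ ω, ‖y n ω - θs‖ ^ 2 ∂P) := by ring
    linarith
  have hgain := mul_le_mul_of_nonneg_left hrate (mul_nonneg (S.nonneg_step n) W.pos_mu.le)
  calc ∫ ω, ‖y (n + 1) ω - θs‖ ^ 2 ∂P
      ≤ ∫ ω, ‖y n ω - θs‖ ^ 2 ∂P - 2 * (α n * μ * (1 / r * ∫ ω, ‖y n ω - θs‖ ^ 2 ∂P))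
        + (α n * B * Real.exp (t * Δ)) ^ 2 := by
        linarith [S.integral_sq_dist_succ_le W n]
    _ = _ := by ring

theorem descentBounds (S : SolverRun P Θ c w lam α y u ζ ξ)
    (W : WeightBounds Θ θs c w m t B μ Δ) :
    DescentBounds (fun n => ∫ ω, ‖y n ω - θs‖ ^ 2 ∂P)
      (fun n => relSqDist P θs c (y n) (u (n + 1))) α lam t B μ Δ where
  lam_le_one := S.lam_mem.2
  pos_t := W.pos_t
  pos_mu := W.pos_mu
  nonneg_B := W.nonneg_B
  nonneg_dist n := integral_nonneg fun ω => sq_nonneg _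
  nonneg_weighted n := (S.relSqDist_mem W n (n + 1)).1
  dist_le_sq_div n := S.integral_sq_dist_le W n fun θ hθ => by
    rw [← div_pow]
    exact pow_le_pow_left₀ (norm_nonneg _) (W.norm_sub_le hθ) 2
  dist_le_range_div n := S.integral_sq_dist_le W n W.sq_norm_sub_le
  weighted_zero_le := (S.relSqDist_zero W).le
  weighted_le n := (S.relSqDist_mem W n (n + 1)).2
  contract n _ hr hrel := S.integral_sq_dist_contract W n hr hrel
  growth n := S.integral_sq_dist_succ_le_add W n
  dist_le_succ n := S.integral_sq_dist_le_succ W n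
  weighted_succ_le n := by
    rw [S.relSqDist_succ W (n + 1)]
    gcongr
    exacts [sub_nonneg.2 S.lam_mem.2, S.relSqDist_drift W n]

end GradientStep

end SolverRun

end SolverRun

section Independence

variable {Ω : Type*} {mΩ : MeasurableSpace Ω} {P : Measure Ω} [IsProbabilityMeasure P]

theorem indep_sup_left {m₁ m₂ m₃ : MeasurableSpace Ω} (h₁ : m₁ ≤ mΩ) (h₂ : m₂ ≤ mΩ) (h₃ : m₃ ≤ mΩ)
    (hind₁ : Indep m₁ (m₂ ⊔ m₃) P) (hind₂ : Indep m₂ m₃ P) : Indep (m₁ ⊔ m₂) m₃ P := by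
  let rectangles : Set (Set Ω) :=
    Set.image2 (· ∩ ·) {s | MeasurableSet[m₁] s} {s | MeasurableSet[m₂] s}
  have hpi : IsPiSystem rectangles := by
    rintro _ ⟨a, ha, b, hb, rfl⟩ _ ⟨a', ha', b', hb', rfl⟩ -
    exact ⟨a ∩ a', ha.inter ha', b ∩ b', hb.inter hb', Set.inter_inter_inter_comm ..⟩
  have hgen : m₁ ⊔ m₂ = MeasurableSpace.generateFrom rectangles := by
    refine le_antisymm (sup_le (fun s hs => ?_) fun s hs => ?_)
      (MeasurableSpace.generateFrom_le ?_)
    · exact MeasurableSpace.measurableSet_generateFrom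
        ⟨s, hs, Set.univ, MeasurableSet.univ, Set.inter_univ s⟩
    · exact MeasurableSpace.measurableSet_generateFrom
        ⟨Set.univ, MeasurableSet.univ, s, hs, Set.univ_inter s⟩
    · rintro _ ⟨a, ha, b, hb, rfl⟩
      exact (le_sup_left (b := m₂) a ha).inter (le_sup_right (a := m₁) b hb)
  refine IndepSets.indep (sup_le h₁ h₂) h₃ hpi (@MeasurableSpace.isPiSystem_measurableSet _ m₃)
    hgen (@MeasurableSpace.generateFrom_measurableSet _ m₃).symm ?_
  rw [IndepSets_iff]
  rintro _ s ⟨a, ha, b, hb, rfl⟩ hs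
  rw [Indep_iff] at hind₁ hind₂
  have hb' : MeasurableSet[m₂ ⊔ m₃] b := le_sup_left (b := m₃) b hb
  have hs' : MeasurableSet[m₂ ⊔ m₃] s := le_sup_right (a := m₂) s hs
  rw [Set.inter_assoc, hind₁ a _ ha (hb'.inter hs'), hind₂ b s hb hs, hind₁ a b ha hb', mul_assoc]

theorem indepFun_of_forall_measurable {α β γ J : Type*} [MeasurableSpace α] [MeasurableSpace β]
    [MeasurableSpace γ] {X : Ω → α} {Z : J → Ω → β} {Y : Ω → γ} (hX : Measurable X)
    (hZ : ∀ j, Measurable (Z j)) (hind : iIndepFun Z P)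
    (hindX : IndepFun X (fun ω j => Z j ω) P) {S : Set J} {j₀ : J} (hj₀ : j₀ ∉ S)
    (hY : ∀ 𝓕 : MeasurableSpace Ω, Measurable[𝓕] X → (∀ j ∈ S, Measurable[𝓕] (Z j)) →
      Measurable[𝓕] Y) : IndepFun Y (Z j₀) P := by
  let σ (j : J) : MeasurableSpace Ω := MeasurableSpace.comap (Z j) inferInstance
  have hσ (j : J) : σ j ≤ MeasurableSpace.comap (fun ω j => Z j ω) MeasurableSpace.pi :=
    ((measurable_pi_apply j).comp (comap_measurable fun ω j => Z j ω)).comap_le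
  have hindσ : Indep (⨆ j ∈ S, σ j) (σ j₀) P := by
    simpa using indep_iSup_of_disjoint (fun j => (hZ j).comap_le) hind
      (Set.disjoint_singleton_right.2 hj₀)
  have hpast : Indep (MeasurableSpace.comap X inferInstance ⊔ ⨆ j ∈ S, σ j) (σ j₀) P :=
    indep_sup_left hX.comap_le (iSup₂_le fun j _ => (hZ j).comap_le) (hZ j₀).comap_le
      (indep_of_indep_of_le_right hindX (sup_le (iSup₂_le fun j _ => hσ j) (hσ j₀))) hindσ
  refine indep_of_indep_of_le_left hpast (hY _ ?_ fun j hj => ?_).comap_le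
  · exact (comap_measurable X).mono le_sup_left le_rfl
  · exact (comap_measurable (Z j)).mono ((le_iSup₂ (f := fun j _ => σ j) j hj).trans le_sup_right)
      le_rfl

end Independence

section WeightPath

theorem measurable_apply_sample {α β ι : Type*} [Countable ι] [MeasurableSpace α]
    [MeasurableSpace β] [MeasurableSpace ι] [MeasurableSingletonClass ι] {Ω : Type*}
    [MeasurableSpace Ω] {g : ι → α → β} (hg : ∀ i, Measurable (g i)) {Z : Ω → ι} {X : Ω → α}
    (hZ : Measurable Z) (hX : Measurable X) : Measurable fun ω => g (Z ω) (X ω) :=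
  (measurable_from_prod_countable_left (f := fun p : α × ι => g p.2 p.1) hg).comp (hX.prodMk hZ)

variable {E ι : Type*} [NormedAddCommGroup E] [InnerProductSpace ℝ E] [Fintype ι]

/-- The parameter and the exponentiated normalizer estimate after `n` iterations of the solver with
weights `c`, unnormalized gradients `w`, averaging parameter `lam`, step sizes `α`, initial
parameter `θ` and samples `ζ`, `ξ`. Iterations are numbered from `1`, as in `solverState`. -/
def weightPath (c : ι → E → ℝ) (w : ι → E → E) (lam : ℝ) (α : ℕ → ℝ) (θ : E) (ζ ξ : ℕ → ι) :
    ℕ → E × ℝ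
  | 0 => (θ, meanWeight c θ)
  | n + 1 =>
    let s := weightPath c w lam α θ ζ ξ n
    let v := (1 - lam) * s.2 + lam * c (ξ (n + 1)) s.1
    (s.1 - (α (n + 1) / v) • w (ζ (n + 1)) s.1, v)

variable [MeasurableSpace E] [BorelSpace E] [SecondCountableTopology E] [MeasurableSpace ι]
  [MeasurableSingletonClass ι] {Ω : Type*} {c : ι → E → ℝ} {w : ι → E → E} {lam : ℝ} {α : ℕ → ℝ}
  {θ₁ : Ω → E} {ζ ξ : ℕ → Ω → ι}

theorem measurable_weightPath {mΩ : MeasurableSpace Ω} (hc : ∀ i, Measurable (c i))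
    (hcm : Measurable (meanWeight c)) (hw : ∀ i, Measurable (w i)) (hθ₁ : Measurable θ₁) (n : ℕ)
    (hζ : ∀ j ≤ n, Measurable (ζ j)) (hξ : ∀ j ≤ n, Measurable (ξ j)) :
    Measurable fun ω => weightPath c w lam α (θ₁ ω) (ζ · ω) (ξ · ω) n := by
  induction n with
  | zero => exact hθ₁.prodMk (hcm.comp hθ₁)
  | succ n ih =>
    have hs := ih (fun j hj => hζ j (by omega)) fun j hj => hξ j (by omega)
    have hv := (hs.snd.const_mul (1 - lam)).add
      ((measurable_apply_sample hc (hξ (n + 1) le_rfl) hs.fst).const_mul lam)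
    exact (hs.fst.sub ((measurable_const.div hv).smul
      (measurable_apply_sample hw (hζ (n + 1) le_rfl) hs.fst))).prodMk hv

theorem measurable_weightPath_succ_snd {mΩ : MeasurableSpace Ω} (hc : ∀ i, Measurable (c i))
    (hcm : Measurable (meanWeight c)) (hw : ∀ i, Measurable (w i)) (hθ₁ : Measurable θ₁) (n : ℕ)
    (hζ : ∀ j ≤ n, Measurable (ζ j)) (hξ : ∀ j ≤ n + 1, Measurable (ξ j)) :
    Measurable fun ω => (weightPath c w lam α (θ₁ ω) (ζ · ω) (ξ · ω) (n + 1)).2 := by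
  have hs := measurable_weightPath (lam := lam) (α := α) hc hcm hw hθ₁ n hζ
    fun j hj => hξ j (by omega)
  exact (hs.snd.const_mul (1 - lam)).add
    ((measurable_apply_sample hc (hξ (n + 1) le_rfl) hs.fst).const_mul lam)

theorem solverRun_weightPath [Nonempty ι] {mΩ : MeasurableSpace Ω} {P : Measure Ω}
    [IsProbabilityMeasure P] {Θ : Set E} {θs : E} {m t B μ Δ : ℝ}
    (W : WeightBounds Θ θs c w m t B μ Δ) (hlam : lam ∈ Set.Icc (0 : ℝ) 1) (hα : ∀ n, 0 ≤ α n)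
    (hθ₁ : Measurable θ₁) (hζ : ∀ k, Measurable (ζ k)) (hξ : ∀ k, Measurable (ξ k))
    (hζu : ∀ k, P.map (ζ k) = (PMF.uniformOfFintype ι).toMeasure)
    (hξu : ∀ k, P.map (ξ k) = (PMF.uniformOfFintype ι).toMeasure)
    (hind : iIndepFun (Sum.elim ζ ξ) P)
    (hind₁ : IndepFun θ₁ (fun ω j => Sum.elim ζ ξ j ω) P)
    (hmem : ∀ n, ∀ᵐ ω ∂P, (weightPath c w lam α (θ₁ ω) (ζ · ω) (ξ · ω) n).1 ∈ Θ) :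
    SolverRun P Θ c w lam (fun n => α (n + 1))
      (fun n ω => (weightPath c w lam α (θ₁ ω) (ζ · ω) (ξ · ω) n).1)
      (fun n ω => (weightPath c w lam α (θ₁ ω) (ζ · ω) (ξ · ω) n).2)
      (fun n => ζ (n + 1)) (fun n => ξ (n + 1)) := by
  have hc := W.measurable_weight
  have hcm := W.measurable_meanWeight
  have hw := W.measurable_grad
  have hpath (n : ℕ) := measurable_weightPath (lam := lam) (α := α) hc hcm hw hθ₁ n
    (fun j _ => hζ j) fun j _ => hξ j
  have hZ : ∀ j, Measurable (Sum.elim ζ ξ j) := Sum.rec hζ hξ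
  refine ⟨hlam, fun n => hα _, fun n => (hpath n).fst, fun n => (hpath n).snd, fun n => hζ _,
    fun n => hξ _, fun n => hζu _, fun n => hξu _, fun n => ?_, fun n => ?_,
    fun _ => rfl, fun _ _ => rfl, fun _ _ => rfl, hmem⟩
  · refine indepFun_of_forall_measurable (j₀ := Sum.inl (n + 1))
      (S := Sum.inl '' Set.Iic n ∪ Sum.inr '' Set.Iic (n + 1)) hθ₁ hZ hind hind₁ (by simp)
      fun 𝓕 hθ hS => ?_
    have hζ' : ∀ j ≤ n, Measurable[𝓕] (ζ j) := fun j hj => hS (Sum.inl j) (by simpa using hj)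
    have hξ' : ∀ j ≤ n + 1, Measurable[𝓕] (ξ j) := fun j hj => hS (Sum.inr j) (by simpa using hj)
    exact (measurable_weightPath hc hcm hw hθ n hζ' fun j hj => hξ' j (by omega)).fst.prodMk
      (measurable_weightPath_succ_snd hc hcm hw hθ n hζ' hξ')
  · refine indepFun_of_forall_measurable (j₀ := Sum.inr (n + 1))
      (S := Sum.inl '' Set.Iic n ∪ Sum.inr '' Set.Iic n) hθ₁ hZ hind hind₁ (by simp)
      fun 𝓕 hθ hS => ?_
    exact (measurable_weightPath hc hcm hw hθ n (fun j hj => hS (Sum.inl j) (by simpa using hj))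
      fun j hj => hS (Sum.inr j) (by simpa using hj)).fst

end WeightPath

section TiltedLoss

theorem measurable_indicator_of_continuousOn {α β : Type*} [TopologicalSpace α] [MeasurableSpace α]
    [OpensMeasurableSpace α] [TopologicalSpace β] [MeasurableSpace β] [BorelSpace β] [Zero β]
    {s : Set α} {g : α → β} (hs : MeasurableSet s) (hg : ContinuousOn g s) :
    Measurable (s.indicator g) := by
  classical
  rw [← Set.piecewise_eq_indicator]
  exact hg.measurable_piecewise continuousOn_const hs

theorem continuousOn_gradient {E : Type*} [NormedAddCommGroup E] [InnerProductSpace ℝ E]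
    [CompleteSpace E] {s : Set E} {g : E → ℝ} (hs : IsOpen s) (hg : ContDiffOn ℝ 1 g s) :
    ContinuousOn (gradient g) s :=
  (InnerProductSpace.toDual ℝ E).symm.continuous.comp_continuousOn
    (hg.continuousOn_fderiv_of_isOpen hs le_rfl)

variable {𝒳 : Type*} {d N : ℕ} {f : 𝒳 → EuclideanSpace ℝ (Fin d) → ℝ} {x : Fin N → 𝒳}
  {t Fmin Fmax B : ℝ} {Θ : Set (EuclideanSpace ℝ (Fin d))} {θ : EuclideanSpace ℝ (Fin d)}

theorem exp_mul_tiltedLossOn (ht : t ≠ 0) {S : Finset (Fin N)} (hS : S.Nonempty)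
    (θ : EuclideanSpace ℝ (Fin d)) :
    Real.exp (t * tiltedLossOn f x t S θ) = 𝔼 i ∈ S, Real.exp (t * f (x i) θ) := by
  have hmean : 0 < 𝔼 i ∈ S, Real.exp (t * f (x i) θ) :=
    Finset.expect_pos (fun i _ => Real.exp_pos _) hS
  rw [tiltedLossOn, ← mul_assoc, mul_one_div_cancel ht, one_mul, one_div_mul_eq_div,
    ← Finset.expect_eq_sum_div_card, Real.exp_log hmean]

/-- The weights `exp (t f(x_i; θ))` of the solver, set to `0` outside of `Θ`, where `f` need not be
measurable. -/
def cutWeight (f : 𝒳 → EuclideanSpace ℝ (Fin d) → ℝ) (x : Fin N → 𝒳) (t : ℝ)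
    (Θ : Set (EuclideanSpace ℝ (Fin d))) (i : Fin N) : EuclideanSpace ℝ (Fin d) → ℝ :=
  Θ.indicator fun θ => Real.exp (t * f (x i) θ)

/-- The unnormalized gradients `exp (t f(x_i; θ)) ∇f(x_i; θ)` of the solver, set to `0` outside of
`Θ`, where `f` need not be measurable. -/
def cutGrad (f : 𝒳 → EuclideanSpace ℝ (Fin d) → ℝ) (x : Fin N → 𝒳) (t : ℝ)
    (Θ : Set (EuclideanSpace ℝ (Fin d))) (i : Fin N) :
    EuclideanSpace ℝ (Fin d) → EuclideanSpace ℝ (Fin d) :=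
  Θ.indicator fun θ => Real.exp (t * f (x i) θ) • gradient (f (x i)) θ

theorem cutGrad_eq_smul (hθ : θ ∈ Θ) (i : Fin N) :
    cutGrad f x t Θ i θ = Real.exp (t * tiltedLoss f x t θ) • tiltedStochGrad f x t i θ := by
  rw [cutGrad, Set.indicator_of_mem hθ, tiltedStochGrad, smul_smul,
    mul_div_cancel₀ _ (Real.exp_pos _).ne']

theorem cutWeight_mem_Icc (ht : 0 < t) (hθ : θ ∈ Θ) {i : Fin N}
    (hF : f (x i) θ ∈ Set.Icc Fmin Fmax) :
    cutWeight f x t Θ i θ ∈ Set.Icc (Real.exp (t * Fmin))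
      (Real.exp (t * (Fmax - Fmin)) * Real.exp (t * Fmin)) := by
  rw [cutWeight, Set.indicator_of_mem hθ, ← Real.exp_add, ← mul_add, sub_add_cancel]
  exact ⟨by gcongr; exact hF.1, by gcongr; exact hF.2⟩

variable [NeZero N]

theorem exp_mul_tiltedLoss (ht : t ≠ 0) (θ : EuclideanSpace ℝ (Fin d)) :
    Real.exp (t * tiltedLoss f x t θ) = 𝔼 i, Real.exp (t * f (x i) θ) :=
  exp_mul_tiltedLossOn ht Finset.univ_nonempty θ

theorem tiltedLoss_mem_Icc (ht : 0 < t) (hF : ∀ i, f (x i) θ ∈ Set.Icc Fmin Fmax) :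
    tiltedLoss f x t θ ∈ Set.Icc Fmin Fmax := by
  have hlower : Real.exp (t * Fmin) ≤ Real.exp (t * tiltedLoss f x t θ) := by
    rw [exp_mul_tiltedLoss ht.ne']
    exact Finset.le_expect Finset.univ_nonempty fun i _ => by gcongr; exact (hF i).1
  have hupper : Real.exp (t * tiltedLoss f x t θ) ≤ Real.exp (t * Fmax) := by
    rw [exp_mul_tiltedLoss ht.ne']
    exact Finset.expect_le Finset.univ_nonempty fun i _ => by gcongr; exact (hF i).2
  exact ⟨le_of_mul_le_mul_left (Real.exp_le_exp.1 hlower) ht,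
    le_of_mul_le_mul_left (Real.exp_le_exp.1 hupper) ht⟩

theorem hasGradientAt_tiltedLoss (ht : t ≠ 0) (hf : ∀ i, DifferentiableAt ℝ (f (x i)) θ) :
    HasGradientAt (tiltedLoss f x t) ((N : ℝ)⁻¹ • ∑ i, tiltedStochGrad f x t i θ) θ := by
  have hexp (i : Fin N) : HasFDerivAt (fun θ => Real.exp (t * f (x i) θ))
      (Real.exp (t * f (x i) θ) • (t • InnerProductSpace.toDual ℝ _ (gradient (f (x i)) θ))) θ :=
    ((hf i).hasGradientAt.hasFDerivAt.const_mul t).exp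
  have hmean := (HasFDerivAt.fun_sum fun i (_ : i ∈ Finset.univ) => hexp i).const_mul
    (1 / (Finset.univ (α := Fin N)).card : ℝ)
  have : 0 < ∑ i, Real.exp (t * f (x i) θ) :=
    Finset.sum_pos (fun i _ => Real.exp_pos _) Finset.univ_nonempty
  have hN : (0 : ℝ) < N := by exact_mod_cast Nat.pos_of_ne_zero (NeZero.ne N)
  have hlog := (hmean.log (by rw [Finset.card_fin]; positivity)).const_mul (1 / t)
  refine hasGradientAt_iff_hasFDerivAt.2 (hlog.congr_fderiv ?_)
  ext v
  simp only [tiltedStochGrad, exp_mul_tiltedLoss ht, Fintype.expect_eq_sum_div_card,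
    Finset.card_fin, Fintype.card_fin, smul_apply, sum_apply, smul_eq_mul,
    InnerProductSpace.toDual_apply_apply, inner_smul_left, sum_inner, Finset.mul_sum, conj_trivial]
  refine Finset.sum_congr rfl fun i _ => ?_
  rw [← Finset.mul_sum]
  field_simp

theorem inner_gradient_tiltedLoss (ht : t ≠ 0) (hf : ∀ i, DifferentiableAt ℝ (f (x i)) θ)
    (v : EuclideanSpace ℝ (Fin d)) :
    inner ℝ (gradient (tiltedLoss f x t) θ) v = 𝔼 i, inner ℝ (tiltedStochGrad f x t i θ) v := by
  rw [(hasGradientAt_tiltedLoss ht hf).gradient, real_inner_smul_left, sum_inner,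
    Fintype.expect_eq_sum_div_card, Fintype.card_fin, inv_mul_eq_div]

theorem norm_gradient_tiltedLoss_le (ht : t ≠ 0) (hf : ∀ i, DifferentiableAt ℝ (f (x i)) θ)
    (hB : ∀ i, ‖tiltedStochGrad f x t i θ‖ ≤ B) : ‖gradient (tiltedLoss f x t) θ‖ ≤ B := by
  have hsum : ‖∑ i, tiltedStochGrad f x t i θ‖ ≤ N * B := by
    simpa using norm_sum_le_of_le Finset.univ fun i _ => hB i
  have hN : (0 : ℝ) < N := by exact_mod_cast Nat.pos_of_ne_zero (NeZero.ne N)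
  rwa [(hasGradientAt_tiltedLoss ht hf).gradient, norm_smul, norm_inv, Real.norm_natCast,
    inv_mul_le_iff₀ hN]

theorem tiltedLoss_sub_le (ht : t ≠ 0) (hΘ : Convex ℝ Θ)
    (hf : ∀ i, ∀ θ ∈ Θ, DifferentiableAt ℝ (f (x i)) θ)
    (hB : ∀ i, ∀ θ ∈ Θ, ‖tiltedStochGrad f x t i θ‖ ≤ B) {θ' : EuclideanSpace ℝ (Fin d)}
    (hθ : θ ∈ Θ) (hθ' : θ' ∈ Θ) :
    tiltedLoss f x t θ - tiltedLoss f x t θ' ≤ B * ‖θ - θ'‖ :=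
  (Real.le_norm_self _).trans <| hΘ.norm_image_sub_le_of_norm_hasFDerivWithin_le
    (fun θ hθ => (hasGradientAt_tiltedLoss ht fun i =>
      hf i θ hθ).differentiableAt.hasGradientAt.hasFDerivAt.hasFDerivWithinAt)
    (fun θ hθ => by
      rw [LinearIsometryEquiv.norm_map]
      exact norm_gradient_tiltedLoss_le ht (fun i => hf i θ hθ) fun i => hB i θ hθ) hθ' hθ

theorem meanWeight_cutWeight (ht : t ≠ 0) (hθ : θ ∈ Θ) :
    meanWeight (cutWeight f x t Θ) θ = Real.exp (t * tiltedLoss f x t θ) := by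
  simp only [meanWeight, cutWeight, Set.indicator_of_mem hθ, exp_mul_tiltedLoss ht]

theorem expect_inner_cutGrad (ht : t ≠ 0) (hf : ∀ i, DifferentiableAt ℝ (f (x i)) θ) (hθ : θ ∈ Θ)
    (v : EuclideanSpace ℝ (Fin d)) :
    𝔼 i, inner ℝ (cutGrad f x t Θ i θ) v =
      Real.exp (t * tiltedLoss f x t θ) * inner ℝ (gradient (tiltedLoss f x t) θ) v := by
  simp only [cutGrad_eq_smul hθ, real_inner_smul_left, inner_gradient_tiltedLoss ht hf,
    Finset.mul_expect]

theorem weightBounds_of_strongConvexOn (hΘ : IsOpen Θ) (ht : 0 < t)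
    (hf : ∀ i, ContDiffOn ℝ 1 (f (x i)) Θ) (hF : ∀ i, ∀ θ ∈ Θ, f (x i) θ ∈ Set.Icc Fmin Fmax)
    {μ : ℝ} (hμ : 0 < μ) (hsc : StrongConvexOn Θ μ (tiltedLoss f x t))
    {θs : EuclideanSpace ℝ (Fin d)} (hs : θs ∈ Θ) (hmin : IsMinOn (tiltedLoss f x t) Θ θs)
    (hB : ∀ i, ∀ θ ∈ Θ, ‖tiltedStochGrad f x t i θ‖ ≤ B) :
    WeightBounds Θ θs (cutWeight f x t Θ) (cutGrad f x t Θ) (Real.exp (t * Fmin)) t B μ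
      (Fmax - Fmin) := by
  have hdiff (i : Fin N) (θ) (hθ : θ ∈ Θ) : DifferentiableAt ℝ (f (x i)) θ :=
    ((hf i).differentiableOn one_ne_zero).differentiableAt (hΘ.mem_nhds hθ)
  refine ⟨Real.exp_pos _, ht, hμ, (norm_nonneg _).trans (hB 0 θs hs), fun i => ?_, fun i => ?_,
    fun i θ hθ => cutWeight_mem_Icc ht hθ (hF i θ hθ), fun i θ hθ => ?_, fun θ hθ => ?_,
    fun θ hθ θ' hθ' => ?_, fun θ hθ => ?_⟩
  · exact measurable_indicator_of_continuousOn hΘ.measurableSet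
      ((hf i).continuousOn.const_smul t).rexp
  · exact measurable_indicator_of_continuousOn hΘ.measurableSet
      (((hf i).continuousOn.const_smul t).rexp.smul (continuousOn_gradient hΘ (hf i)))
  · rw [cutGrad_eq_smul hθ, norm_smul, meanWeight_cutWeight ht.ne' hθ,
      Real.norm_of_nonneg (Real.exp_pos _).le, mul_comm]
    gcongr
    exact hB i θ hθ
  · rw [meanWeight_cutWeight ht.ne' hθ, expect_inner_cutGrad ht.ne' (fun i => hdiff i θ hθ) hθ,
      mul_comm μ, mul_assoc]
    gcongr
    exact mul_sq_norm_sub_le_inner_of_isMinOn hsc hθ hs hmin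
      (hasGradientAt_tiltedLoss ht.ne' fun i => hdiff i θ hθ).differentiableAt.hasGradientAt
  · rw [meanWeight_cutWeight ht.ne' hθ, meanWeight_cutWeight ht.ne' hθ', ← Real.exp_add]
    gcongr
    linarith [mul_le_mul_of_nonneg_left (tiltedLoss_sub_le ht.ne' hsc.1 hdiff hB hθ hθ') ht.le]
  · have hgap := sq_norm_sub_le_sub_of_isMinOn hsc hθ hs hmin
    have hlower := (tiltedLoss_mem_Icc ht fun i => hF i θs hs).1
    have hupper := (tiltedLoss_mem_Icc ht fun i => hF i θ hθ).2
    rw [le_div_iff₀ hμ]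
    linarith

end TiltedLoss

section TermSolver

variable {𝒳 : Type*} {d N : ℕ} {f : 𝒳 → EuclideanSpace ℝ (Fin d) → ℝ} {x : Fin N → 𝒳}
  {t lam L B μ Fmin Fmax : ℝ} {Θ : Set (EuclideanSpace ℝ (Fin d))}
  {θ : EuclideanSpace ℝ (Fin d)}

theorem exp_mul_updateNormalizer_singleton (ht : t ≠ 0) (hlam : lam ∈ Set.Icc (0 : ℝ) 1)
    (i : Fin N) (R : ℝ) :
    Real.exp (t * updateNormalizer f x t lam {i} θ R) =
      (1 - lam) * Real.exp (t * R) + lam * Real.exp (t * f (x i) θ) := by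
  have hpos : 0 < (1 - lam) * Real.exp (t * R) + lam * Real.exp (t * f (x i) θ) :=
    convex_Ioi (0 : ℝ) (Real.exp_pos _) (Real.exp_pos _) (sub_nonneg.2 hlam.2) hlam.1
      (sub_add_cancel 1 lam)
  rw [updateNormalizer, exp_mul_tiltedLossOn ht (Finset.singleton_nonempty i),
    Finset.expect_singleton, ← mul_assoc, mul_one_div_cancel ht, one_mul, Real.exp_log hpos]

theorem updateParam_singleton (hθ : θ ∈ Θ) (α : ℝ) (i : Fin N) (R : ℝ) :
    updateParam f x t α {i} θ R = θ - (α / Real.exp (t * R)) • cutGrad f x t Θ i θ := by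
  rw [updateParam, Finset.sum_singleton, Finset.card_singleton, Nat.cast_one, div_one, Real.exp_sub,
    cutGrad, Set.indicator_of_mem hθ, smul_smul, smul_smul, ← mul_div_assoc, div_mul_eq_mul_div]

theorem weightPath_eq_solverState [NeZero N] (ht : t ≠ 0) (hlam : lam ∈ Set.Icc (0 : ℝ) 1)
    {α : ℕ → ℝ} {ζ ξ : ℕ → Fin N} {θ₁ : EuclideanSpace ℝ (Fin d)}
    (hmem : ∀ n, (solverState f x t lam α (fun k => {ζ k}) (fun k => {ξ k}) θ₁ n).1 ∈ Θ) (n : ℕ) :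
    weightPath (cutWeight f x t Θ) (cutGrad f x t Θ) lam α θ₁ ζ ξ n =
      ((solverState f x t lam α (fun k => {ζ k}) (fun k => {ξ k}) θ₁ n).1,
        Real.exp (t * (solverState f x t lam α (fun k => {ζ k}) (fun k => {ξ k}) θ₁ n).2)) := by
  induction n with
  | zero => exact Prod.ext rfl (meanWeight_cutWeight ht (hmem 0))
  | succ n ih =>
    rw [weightPath, ih, solverState]
    simp only [updateParam_singleton (hmem n), exp_mul_updateNormalizer_singleton ht hlam,
      cutWeight, Set.indicator_of_mem (hmem n)]

theorem exists_descentBounds_of_solverState [NeZero N] {θs : EuclideanSpace ℝ (Fin d)} {m Δ : ℝ}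
    (W : WeightBounds Θ θs (cutWeight f x t Θ) (cutGrad f x t Θ) m t B μ Δ)
    (hlam : lam ∈ Set.Icc (0 : ℝ) 1) {α : ℕ → ℝ} (hα : ∀ k, 0 ≤ α k)
    {Ω : Type*} [MeasurableSpace Ω] {P : Measure Ω} [IsProbabilityMeasure P]
    {θ₁ : Ω → EuclideanSpace ℝ (Fin d)} (hθ₁ : Measurable θ₁) {ζ ξ : ℕ → Ω → Fin N}
    (hζ : ∀ k, Measurable (ζ k)) (hξ : ∀ k, Measurable (ξ k))
    (hζu : ∀ k, P.map (ζ k) = (PMF.uniformOfFintype (Fin N)).toMeasure)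
    (hξu : ∀ k, P.map (ξ k) = (PMF.uniformOfFintype (Fin N)).toMeasure)
    (hind : iIndepFun (Sum.elim ζ ξ) P) (hind₁ : IndepFun θ₁ (fun ω j => Sum.elim ζ ξ j ω) P)
    {y : ℕ → Ω → EuclideanSpace ℝ (Fin d)}
    (hy : ∀ n ω, y n ω =
      (solverState f x t lam α (fun k => {ζ k ω}) (fun k => {ξ k ω}) (θ₁ ω) n).1)
    (hmem : ∀ᵐ ω ∂P, ∀ n, y n ω ∈ Θ) :
    (∀ n, Integrable (fun ω => ‖y n ω - θs‖ ^ 2) P) ∧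
      ∃ Q,
        DescentBounds (fun n => ∫ ω, ‖y n ω - θs‖ ^ 2 ∂P) Q (fun n => α (n + 1)) lam t B μ Δ := by
  let path (n : ℕ) (ω : Ω) :=
    weightPath (cutWeight f x t Θ) (cutGrad f x t Θ) lam α (θ₁ ω) (ζ · ω) (ξ · ω) n
  have hpath (n : ℕ) : ∀ᵐ ω ∂P, (path n ω).1 = y n ω := by
    filter_upwards [hmem] with ω hω
    simp only [path, weightPath_eq_solverState W.pos_t.ne' hlam fun n => hy n ω ▸ hω n, hy]
  have hpath_mem (n : ℕ) : ∀ᵐ ω ∂P, (path n ω).1 ∈ Θ := by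
    filter_upwards [hpath n, hmem] with ω hn hω
    exact hn ▸ hω n
  have hsq (n : ℕ) : (fun ω => ‖(path n ω).1 - θs‖ ^ 2) =ᵐ[P] fun ω => ‖y n ω - θs‖ ^ 2 :=
    (hpath n).mono fun ω hω => congrArg (‖· - θs‖ ^ 2) hω
  have S := solverRun_weightPath W hlam hα hθ₁ hζ hξ hζu hξu hind hind₁ hpath_mem
  have hD : (fun n => ∫ ω, ‖y n ω - θs‖ ^ 2 ∂P) = fun n => ∫ ω, ‖(path n ω).1 - θs‖ ^ 2 ∂P :=
    funext fun n => (integral_congr_ae (hsq n)).symm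
  exact ⟨fun n => (S.integrable_sq_dist W n).congr (hsq n), _, hD ▸ S.descentBounds W⟩

theorem avgParam_mem_Icc : avgParam ∈ Set.Icc (0 : ℝ) 1 := by
  have he := Real.add_one_le_exp 1
  rw [avgParam, Set.mem_Icc, sub_nonneg, div_le_one (by positivity)]
  exact ⟨by linarith, sub_le_self 1 (by positivity)⟩

theorem one_sub_avgParam_le : 1 - avgParam ≤ 0.185 := by
  rw [avgParam, sub_sub_cancel, div_le_iff₀ (by positivity)]
  linarith [Real.exp_one_gt_d9]

theorem stepSize_nonneg (ht : 0 ≤ t) (hL : 0 ≤ L) (hB : 0 ≤ B) (hμ : 0 ≤ μ) (k : ℕ) :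
    0 ≤ stepSize t L B μ Fmin Fmax k := by
  rw [stepSize]
  split_ifs <;> positivity

theorem one_le_burnIn (t L B μ Fmin Fmax : ℝ) : 1 ≤ burnIn t L B μ Fmin Fmax :=
  le_max_left _ _

theorem mul_lt_of_lt_burnIn_bound (ht : 0 ≤ t) (hL : 0 ≤ L) (hB : 0 ≤ B) (hμ : 0 < μ) {k : ℕ}
    (hk : 1 ≤ k) (hk' : (k : ℝ) < 2 * Real.exp 1 / μ
      + Real.exp 1 * t * L * B * Real.exp (t * (Fmax - Fmin)) / (μ * k)) :
    μ * k < 2 * Real.exp 1 + Real.exp 1 * t * L * B * Real.exp (t * (Fmax - Fmin)) := by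
  have hk1 : (1 : ℝ) ≤ k := by exact_mod_cast hk
  rw [← lt_div_iff₀' hμ, add_div]
  refine hk'.trans_le ?_
  gcongr
  exact le_mul_of_one_le_right hμ.le hk1

theorem mul_burnIn_lt (ht : 0 ≤ t) (hL : 0 ≤ L) (hB : 0 ≤ B) (hμ : 0 < μ)
    (hburn : 1 < burnIn t L B μ Fmin Fmax) :
    μ * burnIn t L B μ Fmin Fmax <
      2 * Real.exp 1 + Real.exp 1 * t * L * B * Real.exp (t * (Fmax - Fmin)) := by
  set A := {k : ℕ | 1 ≤ k ∧ (k : ℝ) < 2 * Real.exp 1 / μ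
    + Real.exp 1 * t * L * B * Real.exp (t * (Fmax - Fmin)) / (μ * k)}
  have hbound (k : ℕ) (hk : k ∈ A) := mul_lt_of_lt_burnIn_bound ht hL hB hμ hk.1 hk.2
  have hsSup : 1 < sSup A := (lt_max_iff.1 hburn).resolve_left (lt_irrefl 1)
  have hne : A.Nonempty := Set.nonempty_iff_ne_empty.2 fun h => by
    rw [h, csSup_empty] at hsSup
    exact Nat.not_lt_zero 1 hsSup
  have hbdd : BddAbove A := by
    refine ⟨⌈(2 * Real.exp 1 + Real.exp 1 * t * L * B * Real.exp (t * (Fmax - Fmin))) / μ⌉₊,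
      fun k hk => Nat.cast_le.1 (le_trans ?_ (Nat.le_ceil _))⟩
    exact ((lt_div_iff₀' hμ).2 (hbound k hk)).le
  rw [show burnIn t L B μ Fmin Fmax = sSup A from max_eq_right hsSup.le]
  exact hbound _ (Nat.sSup_mem hne hbdd)

theorem stepSize_of_lt_burnIn {k : ℕ} (hk : k < burnIn t L B μ Fmin Fmax) :
    stepSize t L B μ Fmin Fmax k = 1 / (t * L * B * Real.exp (t * (Fmax - Fmin)) + 1) :=
  if_pos hk

theorem stepSize_of_burnIn_le {k : ℕ} (hk : burnIn t L B μ Fmin Fmax ≤ k) :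
    stepSize t L B μ Fmin Fmax k = 2 * Real.exp 1 / (μ * k) :=
  if_neg hk.not_gt

theorem stepSize_le (ht : 0 ≤ t) (hL : 0 ≤ L) (hB : 0 ≤ B) (hμ : 0 < μ) {k : ℕ} (hk : 1 ≤ k) :
    stepSize t L B μ Fmin Fmax k ≤ 2 * Real.exp 1 / (μ * k) := by
  obtain hlt | hle := lt_or_ge k (burnIn t L B μ Fmin Fmax)
  · have : (0 : ℝ) < k := by exact_mod_cast hk
    have hkb : μ * k ≤ μ * burnIn t L B μ Fmin Fmax := by gcongr
    have hnonneg : 0 ≤ Real.exp 1 * t * L * B * Real.exp (t * (Fmax - Fmin)) := by positivity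
    rw [stepSize_of_lt_burnIn hlt, div_le_div_iff₀ (by positivity) (by positivity)]
    linarith [mul_burnIn_lt ht hL hB hμ (hk.trans_lt hlt)]
  · exact (stepSize_of_burnIn_le hle).le

end TermSolver

end TERM

end

theorem mainTheorem9_general {𝒳 : Type*} {d N : ℕ} [NeZero N]
    (x : Fin N → 𝒳) (f : 𝒳 → EuclideanSpace ℝ (Fin d) → ℝ)
    (Θ : Set (EuclideanSpace ℝ (Fin d))) (hΘ : IsOpen Θ)
    (t : ℝ) (ht : 0 < t)
    (hf : ∀ i, ContDiffOn ℝ 1 (f (x i)) Θ)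
    (Fmin Fmax : ℝ) (hF : ∀ i, ∀ θ ∈ Θ, f (x i) θ ∈ Set.Icc Fmin Fmax)
    (L : ℝ) (hL0 : 0 ≤ L)
    (μ : ℝ) (hμ : 0 < μ) (hsc : StrongConvexOn Θ μ (TERM.tiltedLoss f x t))
    (θstar : EuclideanSpace ℝ (Fin d)) (hstarΘ : θstar ∈ Θ)
    (hstar : IsMinOn (TERM.tiltedLoss f x t) Θ θstar)
    (B : ℝ) (hB : ∀ i, ∀ θ ∈ Θ, ‖TERM.tiltedStochGrad f x t i θ‖ ≤ B)
    {Ω : Type*} [MeasurableSpace Ω] (P : Measure Ω) [IsProbabilityMeasure P]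
    (θ₁ : Ω → EuclideanSpace ℝ (Fin d)) (hθ₁ : Measurable θ₁)
    (ζ ξ : ℕ → Ω → Fin N) (hζ : ∀ k, Measurable (ζ k)) (hξ : ∀ k, Measurable (ξ k))
    (hζu : ∀ k, P.map (ζ k) = (PMF.uniformOfFintype (Fin N)).toMeasure)
    (hξu : ∀ k, P.map (ξ k) = (PMF.uniformOfFintype (Fin N)).toMeasure)
    (hind : iIndepFun (fun j : ℕ ⊕ ℕ => Sum.elim ζ ξ j) P)
    (hind₁ : IndepFun θ₁ (fun ω (j : ℕ ⊕ ℕ) => Sum.elim ζ ξ j ω) P)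
    (θ : ℕ → Ω → EuclideanSpace ℝ (Fin d))
    (hθ : ∀ k ω, θ k ω = TERM.termIterate f x t L B μ Fmin Fmax
      (fun j => ζ j ω) (fun j => ξ j ω) (θ₁ ω) k)
    (hθΘ : ∀ᵐ ω ∂P, ∀ k, 1 ≤ k → θ k ω ∈ Θ)
    (kt : ℕ) (hkt : kt = TERM.burnIn t L B μ Fmin Fmax)
    (Vt : ℝ) (hVt : Vt = max (kt * ∫ ω, ‖θ kt ω - θstar‖ ^ 2 ∂P)
      (4 * B ^ 2 * Real.exp (2 + 2 * t * (Fmax - Fmin)) / μ ^ 2)) :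
    (∀ k, 1 ≤ k → Integrable (fun ω => ‖θ k ω - θstar‖ ^ 2) P) ∧
    (∀ k, kt ≤ k → ∫ ω, ‖θ (k + 1) ω - θstar‖ ^ 2 ∂P ≤ Vt / (k + 1)) ∧
    ∫ ω, ‖θ kt ω - θstar‖ ^ 2 ∂P ≤
      max (∫ ω, ‖θ 1 ω - θstar‖ ^ 2 ∂P)
        (B ^ 2 * Real.exp (2 * t * (Fmax - Fmin) + 1)
          / (μ * (1 + t * L * B * Real.exp (t * (Fmax - Fmin))))) := by
  subst hVt
  have W := TERM.weightBounds_of_strongConvexOn hΘ ht hf hF hμ hsc hstarΘ hstar hB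
  have hα := TERM.stepSize_nonneg (Fmin := Fmin) (Fmax := Fmax) ht.le hL0 W.nonneg_B hμ.le
  obtain ⟨hint, Q, H⟩ := TERM.exists_descentBounds_of_solverState W TERM.avgParam_mem_Icc hα hθ₁
    hζ hξ hζu hξu hind hind₁ (fun n => hθ (n + 1)) (hθΘ.mono fun ω hω n => hω (n + 1) n.succ_pos)
  obtain ⟨K, rfl⟩ := Nat.exists_eq_add_of_le' (hkt ▸ TERM.one_le_burnIn t L B μ Fmin Fmax)
  refine ⟨fun k hk => ?_, fun k hk => ?_, ?_⟩
  · obtain ⟨n, rfl⟩ := Nat.exists_eq_add_of_le' hk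
    exact hint n
  · refine H.dist_le_div_of_harmonic_step TERM.one_sub_avgParam_le (fun n => hα (n + 1))
      (fun n => ?_) (K := K) (fun n hn => ?_) ?_ (le_max_right _ _) k (by omega)
    · exact_mod_cast TERM.stepSize_le ht.le hL0 W.nonneg_B hμ n.succ_pos
    · exact_mod_cast TERM.stepSize_of_burnIn_le (by omega)
    · exact_mod_cast le_max_left _ _
  · have hB0 := W.nonneg_B
    have hconst := H.dist_le_max_of_const_step TERM.one_sub_avgParam_le (by positivity) (K := K)
      (fun n hn => TERM.stepSize_of_lt_burnIn (by omega)) K le_rfl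
    rwa [TERM.noiseFloor_eq_sq_mul, mul_one_div, div_div, mul_comm _ μ,
      add_comm (t * L * B * _)] at hconst

theorem mainTheorem9 {𝒳 : Type*} {d N : ℕ} [NeZero N]
    -- data, loss, open parameter domain, tilt
    (x : Fin N → 𝒳) (f : 𝒳 → EuclideanSpace ℝ (Fin d) → ℝ)
    (Θ : Set (EuclideanSpace ℝ (Fin d))) (hΘ : IsOpen Θ)
    (t : ℝ) (ht : 0 < t)
    (hf : ∀ i, ContDiffOn ℝ 1 (f (x i)) Θ)
    -- bounded `L`-Lipschitz losses
    (Fmin Fmax : ℝ) (hF : ∀ a, ∀ θ ∈ Θ, f a θ ∈ Set.Icc Fmin Fmax)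
    (L : ℝ) (hL0 : 0 ≤ L)
    (hL : ∀ a, ∀ θ ∈ Θ, ∀ θ' ∈ Θ, |f a θ - f a θ'| ≤ L * ‖θ - θ'‖)
    -- strongly convex tilted objective with minimizer `θstar`
    (μ : ℝ) (hμ : 0 < μ) (hsc : StrongConvexOn Θ μ (TERM.tiltedLoss f x t))
    (θstar : EuclideanSpace ℝ (Fin d)) (hstarΘ : θstar ∈ Θ)
    (hstar : IsMinOn (TERM.tiltedLoss f x t) Θ θstar)
    -- bounded stochastic gradients
    (B : ℝ) (hB : ∀ i, ∀ θ ∈ Θ, ‖TERM.tiltedStochGrad f x t i θ‖ ≤ B)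
    -- initial parameter and independent uniform samples
    {Ω : Type*} [MeasurableSpace Ω] (P : Measure Ω) [IsProbabilityMeasure P]
    (θ₁ : Ω → EuclideanSpace ℝ (Fin d)) (hθ₁ : Measurable θ₁)
    (ζ ξ : ℕ → Ω → Fin N) (hζ : ∀ k, Measurable (ζ k)) (hξ : ∀ k, Measurable (ξ k))
    (hζu : ∀ k, P.map (ζ k) = (PMF.uniformOfFintype (Fin N)).toMeasure)
    (hξu : ∀ k, P.map (ξ k) = (PMF.uniformOfFintype (Fin N)).toMeasure)
    (hind : iIndepFun (fun j : ℕ ⊕ ℕ => Sum.elim ζ ξ j) P)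
    (hind₁ : IndepFun θ₁ (fun ω (j : ℕ ⊕ ℕ) => Sum.elim ζ ξ j ω) P)
    -- the iterates, which stay in the parameter domain
    (θ : ℕ → Ω → EuclideanSpace ℝ (Fin d))
    (hθ : ∀ k ω, θ k ω = TERM.termIterate f x t L B μ Fmin Fmax
      (fun j => ζ j ω) (fun j => ξ j ω) (θ₁ ω) k)
    (hθΘ : ∀ᵐ ω ∂P, ∀ k, 1 ≤ k → θ k ω ∈ Θ)
    (kt : ℕ) (hkt : kt = TERM.burnIn t L B μ Fmin Fmax)
    (Vt : ℝ) (hVt : Vt = max (kt * ∫ ω, ‖θ kt ω - θstar‖ ^ 2 ∂P)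
      (4 * B ^ 2 * Real.exp (2 + 2 * t * (Fmax - Fmin)) / μ ^ 2)) :
    (∀ k, 1 ≤ k → Integrable (fun ω => ‖θ k ω - θstar‖ ^ 2) P) ∧
    (∀ k, kt ≤ k → ∫ ω, ‖θ (k + 1) ω - θstar‖ ^ 2 ∂P ≤ Vt / (k + 1)) ∧
    ∫ ω, ‖θ kt ω - θstar‖ ^ 2 ∂P ≤
      max (∫ ω, ‖θ 1 ω - θstar‖ ^ 2 ∂P)
        (B ^ 2 * Real.exp (2 * t * (Fmax - Fmin) + 1)
          / (μ * (1 + t * L * B * Real.exp (t * (Fmax - Fmin))))) := by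
  exact mainTheorem9_general x f Θ hΘ t ht hf Fmin Fmax (fun i => hF (x i)) L hL0 μ hμ hsc θstar
    hstarΘ hstar B hB P θ₁ hθ₁ ζ ξ hζ hξ hζu hξu hind hind₁ θ hθ hθΘ kt hkt Vt hVt
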